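/- **Setting.** Let $0<\Delta<1$ and $\alpha=1-\Delta$. For a nonzero vector $A\in\mathbb{R}^D$ with nonnegative entries put $F_{(\alpha)}=\sum_i A_i^{\alpha}$, $F_{(1)}=\sum_i A_i$ and $H=-\sum_i\frac{A_i}{F_{(1)}}\log\frac{A_i}{F_{(1)}}$. Let $v_{ij}$ (uniform on $(0,\pi)$) and $w_{ij}$ (exponential with mean $1$), $1\le i\le D$, $1\le j\le k$, be independent, and let $$r_{ij}=\frac{\sin(\alpha v_{ij})}{(\sin v_{ij})^{1/\alpha}}\Big[\frac{\sin(\Delta v_{ij})}{w_{ij}}\Big]^{\Delta/\alpha},\qquad x_j=\sum_{i=1}^D r_{ij}A_i,\qquad \hat F_{(\alpha)}=\frac1{\Delta^{\Delta}}\Big[\frac{k}{\sum_{j=1}^k x_j^{-\alpha/\Delta}}\Big]^{\Delta}.$$ **Constants.** Let $Y=r^{-\alpha/\Delta}$ with $r$ distributed as $r_{11}$, let $M(s)=\mathbb{E}\,e^{sY}$ and $M'(s)=\mathbb{E}[Y e^{sY}]$. For $\epsilon=\nu\Delta$ with $0<\nu<1$ let $t_R>0$ and $t_L\in(0,\Delta\alpha^{\alpha/\Delta})$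 be the solutions of $$-\frac{M'(-t_R)}{M(-t_R)}+\frac{1}{(1+\epsilon)^{1/\Delta}\Delta}=0,\qquad -\frac{M'(t_L)}{M(t_L)}+\frac{1}{(1-\epsilon)^{1/\Delta}\Delta}=0,$$ and define $G_R$, $G_L$ by $$\frac{\epsilon^2}{G_R}=-\Big(\log M(-t_R)+\frac{t_R}{(1+\epsilon)^{1/\Delta}\Delta}\Big),\qquad \frac{\epsilon^2}{G_L}=-\log M(t_L)+\frac{t_L}{(1-\epsilon)^{1/\Delta}\Delta}.$$ **Claim.** There are absolute constants $C>0$ and $\nu_0>0$ such that the following hold. 1. For $0<\Delta<1$ and $|s|<\Delta\alpha^{\alpha/\Delta}$, the series below converge and $$M(s)=\sum_{n\ge0}\frac{s^n}{n!}\frac{\Gamma(1+n/\Delta)}{\Gamma(1+n\alpha/\Delta)},\qquad M'(s)=\sum_{n\ge1}\frac{s^{n-1}}{(n-1)!}\frac{\Gamma(1+n/\Delta)}{\Gamma(1+n\alpha/\Delta)}.$$ 2. For all $\Delta,\nu\in(0,1)$ and $\epsilon=\nu\Delta$: $t_R$ and $t_L$ exist and are unique; $t_R<\Delta\alpha^{\alpha/\Delta}$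 if $\nu<\nu_0$; for all $D$, $k$ and $A$, $$\Pr\big(\hat F_{(\alpha)}\ge(1+\epsilon)F_{(\alpha)}\big)\le e^{-k\epsilon^2/G_R},\qquad \Pr\big(\hat F_{(\alpha)}\le(1-\epsilon)F_{(\alpha)}\big)\le e^{-k\epsilon^2/G_L};$$ and $0<G_R\le C\Delta^2$, $0<G_L\le C\Delta^2$, $\epsilon^2/G_R\le C$, and, if $\Delta\le\frac12$, $\epsilon^2/G_L\le C$. 3. For all $\Delta,\nu,\delta\in(0,1)$, all $D$ and $A$, and every $k\ge C\log(2/\delta)/\nu^2$, with probability at least $1-\delta$, $$|\hat F_{(\alpha)}-F_{(\alpha)}|\le\nu\Delta\,F_{(\alpha)}.$$ 4. For all $D$ and $\nu\in(0,1)$ there is $\Delta_0\in(0,1)$ such that, for all $0<\Delta<\Delta_0$, $\delta\in(0,1)$, every $k\ge C\log(2/\delta)/\nu^2$ and every stream of updates $(i,I)\in\{1,\dots,D\}\times\mathbb{R}$ (starting from the zero vector, an update adds $I$ to the $i$-th coordinate) whose final vector $A$ is nonnegative and nonzero, the following holds. The one-pass algorithm that stores the $k$ numbers $x_j$ and the counter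 $F_{(1)}$, updated by $x_j\leftarrow x_j+I\,r_{ij}$ and $F_{(1)}\leftarrow F_{(1)}+I$, gives, with probability at least $1-\delta$, both $$\Big|\frac1\Delta\log\frac{\hat F_{(\alpha)}}{F_{(1)}^{\alpha}}-H\Big|\le\nu\qquad\text{and}\qquad\Big|\frac1\Delta\Big(\frac{\hat F_{(\alpha)}}{F_{(1)}^{\alpha}}-1\Big)-H\Big|\le\nu.$$ -/

import Mathlib

open MeasureTheory ProbabilityTheory

namespace CompressedCounting

noncomputable section

/-! ### Streams, moments and entropies (throughout `α = 1 - Δ`, `0 < Δ < 1`) -/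

/-- The vector `A` described by a Turnstile stream of updates `(i, I)`, each of which adds the
(positive or negative) increment `I` to the coordinate `i` of a vector that is initially zero. -/
def streamVector {D : ℕ} (stream : List (Fin D × ℝ)) : Fin D → ℝ :=
  stream.foldl (fun A a => Function.update A a.1 (A a.1 + a.2)) (fun _ => 0)

/-- The frequency moment `F_(α) = ∑ i, A[i] ^ α` with `α = 1 - Δ`. -/
def moment {D : ℕ} (Δ : ℝ) (A : Fin D → ℝ) : ℝ := ∑ i, A i ^ (1 - Δ)

/-- The first moment `F_(1)`. -/
def total {D : ℕ} (A : Fin D → ℝ) : ℝ := ∑ i, A i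

/-- The Shannon entropy (natural logarithm, `0 log 0 = 0`) of the vector `A`. -/
def shannonEntropy {D : ℕ} (A : Fin D → ℝ) : ℝ :=
  -∑ i, A i / total A * Real.log (A i / total A)

/-- The Rényi entropy of order `1 - Δ`, as a function of the values `F` of `F_(α)` and `F₁` of
`F_(1)`. -/
def renyi (Δ F F₁ : ℝ) : ℝ := 1 / Δ * Real.log (F / F₁ ^ (1 - Δ))

/-- The Tsallis entropy of order `1 - Δ`, as a function of the values `F` of `F_(α)` and `F₁` of
`F_(1)`. -/
def tsallis (Δ F F₁ : ℝ) : ℝ := 1 / Δ * (F / F₁ ^ (1 - Δ) - 1)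

/-! ### Maximally skewed stable random projections -/

/-- The generator of the maximally skewed `α`-stable law: an entry of the projection matrix is
`stableGen Δ v w` with `v` uniform on `(0, π)` and `w` standard exponential. -/
def stableGen (Δ v w : ℝ) : ℝ :=
  Real.sin ((1 - Δ) * v) / Real.sin v ^ (1 / (1 - Δ)) *
    (Real.sin (v * Δ) / w) ^ (Δ / (1 - Δ))

/-- The uniform distribution on `(0, π)`. -/
def uniformLaw : Measure ℝ := ProbabilityTheory.cond volume (Set.Ioo 0 Real.pi)

/-- The variables `v i j`, `w i j` are all independent, each `v i j` is uniform on `(0, π)` and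
each `w i j` is exponential with mean `1`. -/
structure IsSource {Ω : Type*} [MeasurableSpace Ω] (μ : Measure Ω) {D k : ℕ}
    (v w : Fin D → Fin k → Ω → ℝ) : Prop where
  law_v : ∀ i j, HasLaw (v i j) uniformLaw μ
  law_w : ∀ i j, HasLaw (w i j) (expMeasure 1) μ
  indep : iIndepFun (Sum.elim (fun p : Fin D × Fin k => v p.1 p.2)
    (fun p : Fin D × Fin k => w p.1 p.2)) μ

/-- The random projection matrix. -/
def projMatrix {Ω : Type*} {D k : ℕ} (Δ : ℝ) (v w : Fin D → Fin k → Ω → ℝ) (ω : Ω) :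
    Fin D → Fin k → ℝ :=
  fun i j => stableGen Δ (v i j ω) (w i j ω)

/-- The projected data `x_j = ∑ i, r i j * A i`. -/
def project {D k : ℕ} (R : Fin D → Fin k → ℝ) (A : Fin D → ℝ) : Fin k → ℝ :=
  fun j => ∑ i, R i j * A i

/-- The estimator `Δ ^ (-Δ) * (k / ∑ j, x_j ^ (-α / Δ)) ^ Δ` of `F_(α)`. -/
def estimator {k : ℕ} (Δ : ℝ) (x : Fin k → ℝ) : ℝ :=
  1 / Δ ^ Δ * ((k : ℝ) / ∑ j, x j ^ (-(1 - Δ) / Δ)) ^ Δ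

/-- The one-pass algorithm: it stores `k` samples and one counter, all initially zero; an update
`(i, I)` adds `I * r i j` to the `j`-th sample and `I` to the counter. -/
def sketch {D k : ℕ} (R : Fin D → Fin k → ℝ) (stream : List (Fin D × ℝ)) :
    (Fin k → ℝ) × ℝ :=
  stream.foldl (fun s a => (fun j => s.1 j + a.2 * R a.1 j, s.2 + a.2)) (fun _ => 0, 0)

/-! ### The constants of the tail bounds -/

/-- The normalised statistic `x ^ (-α / Δ) / F_(α) ^ (-1 / Δ)` of one sample, written for a
one-coordinate vector with entry `1`, as a function of `(v, w)`. -/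
def statistic (Δ : ℝ) (p : ℝ × ℝ) : ℝ := stableGen Δ p.1 p.2 ^ (-(1 - Δ) / Δ)

/-- The moment generating function `s ↦ E exp (s Y)` of the normalised statistic `Y`. -/
def M (Δ s : ℝ) : ℝ :=
  ∫ p, Real.exp (s * statistic Δ p) ∂(uniformLaw.prod (expMeasure 1))

/-- The derivative `s ↦ E (Y exp (s Y))` of the moment generating function. -/
def M' (Δ s : ℝ) : ℝ :=
  ∫ p, statistic Δ p * Real.exp (s * statistic Δ p) ∂(uniformLaw.prod (expMeasure 1))

/-- The ratio `Γ(1 + n / Δ) / Γ(1 + n α / Δ)`. -/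
def gammaRatio (Δ : ℝ) (n : ℕ) : ℝ :=
  Real.Gamma (1 + n / Δ) / Real.Gamma (1 + n * (1 - Δ) / Δ)

/-- The radius of convergence `Δ * α ^ (α / Δ)` of `∑ n, s ^ n / n! * gammaRatio Δ n`. -/
def radius (Δ : ℝ) : ℝ := Δ * (1 - Δ) ^ ((1 - Δ) / Δ)

/-- The equation that determines `t_R`. -/
def IsRightPoint (Δ ε t : ℝ) : Prop :=
  0 < t ∧ -M' Δ (-t) / M Δ (-t) + 1 / ((1 + ε) ^ (1 / Δ) * Δ) = 0

/-- The equation that determines `t_L`. -/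
def IsLeftPoint (Δ ε t : ℝ) : Prop :=
  0 < t ∧ t < radius Δ ∧ -(M' Δ t / M Δ t) + 1 / ((1 - ε) ^ (1 / Δ) * Δ) = 0

/-- The quantity `ε ^ 2 / G_R`, for `t = t_R`. -/
def rightRate (Δ ε t : ℝ) : ℝ :=
  -(Real.log (M Δ (-t)) + t / ((1 + ε) ^ (1 / Δ) * Δ))

/-- The quantity `ε ^ 2 / G_L`, for `t = t_L`. -/
def leftRate (Δ ε t : ℝ) : ℝ :=
  -Real.log (M Δ t) + t / ((1 - ε) ^ (1 / Δ) * Δ)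

end

end CompressedCounting

/-! Write `α = 1 - Δ`. Kanter's formula gives `r = (w ^ Δ K(v)) ^ (-1/α)` with `K = kanter Δ`, so `Y
= r ^ (-α/Δ) = w K(v) ^ (1/Δ)`: given `v`, the statistic is exponential with mean `weight Δ v`.
Hence `M(s) = E 1 / (1 - s weight(v))`, where `weight` has mean `1/Δ` and supremum `1 / radius Δ`.

The stable law comes from a trigonometric integral (`integral_kanter_pow`). Since `K ^ n` is the
value of `(1 + z) ^ n z ^ (-nΔ)` along a curve in the plane, it has an explicit primitive, and `E K
^ n = n! / (Γ(1 + Δn) Γ(1 + αn))`. If `T` is another exponential, then `T ^ α w ^ Δ K(v)` has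
moments `n!` and is therefore standard exponential (`measure_ext_of_moments`, `map_mixture`).
Reading `exp (-l r)` as `P(T > l r)` then gives `E exp (-l r) = exp (-l ^ α)`.

By independence a sample `x` has Laplace transform `exp (-F l ^ α)` with `F = F_(α)`. Its negative
moments follow by integration against powers of `l`, and show that `F ^ (1/Δ) x ^ (-α/Δ)` has the
moments, hence the law, of `Y`, whatever `D` and `A` are (`map_sampleStatistic`). The estimator is a
decreasing function of the sum of these variables, so both tails are Chernoff bounds with the single
function `M`.

The saddle points `t_R`, `t_L` are found by the intermediate value theorem, are unique by strict
monotonicity, and optimise the Chernoff exponent (`saddle_optimal`). The rate is thus at least the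
exponent at the explicit point `Δτ`, where `log M(Δτ) ≤ τ + 6τ²`; a `τ` of order `ν` gives a rate of
order `ν²`, uniformly in `Δ` (`le_rate`).

For the entropy, `p ^ (1 - Δ) - p = -Δ p log p + O(Δ²)` bounds the bias of the exact Tsallis entropy
by `O(DΔ)`, while a relative error `νΔ/4` of the moment costs only `O(ν)` after division by `Δ`. -/

namespace CompressedCounting

noncomputable section

section

/-! ### A trigonometric integral -/

/-- The function `θ ↦ sin (c θ) / c`, read as `θ` for `c = 0`. -/
def sinOver (c θ : ℝ) : ℝ := if c = 0 then θ else Real.sin (c * θ) / c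

lemma mul_sinOver (c θ : ℝ) : c * sinOver c θ = Real.sin (c * θ) := by
  unfold sinOver
  split_ifs with h
  · simp [h]
  · field_simp

lemma hasDerivAt_sinOver (c θ : ℝ) : HasDerivAt (sinOver c) (Real.cos (c * θ)) θ := by
  unfold sinOver
  split_ifs with h
  · simpa [h] using hasDerivAt_id' θ
  · have h1 : HasDerivAt (fun x : ℝ => c * x) c θ := by simpa using (hasDerivAt_id θ).const_mul c
    have := (h1.sin).div_const c
    rwa [mul_div_cancel_right₀ _ h] at this

/-- The sum of the boundary values of the primitive, by Pascal's rule and reflection. -/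
lemma sum_choose_sinOver_pi (n : ℕ) (a : ℝ) :
    ∑ k ∈ Finset.range (n + 1), (n.choose k : ℝ) * sinOver (k - a) Real.pi =
      Real.pi * n.factorial * ((Real.Gamma (1 + a))⁻¹ * (Real.Gamma (1 + n - a))⁻¹) := by
  -- This holds at `s = 0` too, since both `Real.Gamma 0` and the inverse of `0` are `0`. The
  -- induction shifts `a` to `a - 1` and may meet poles.
  have inv_Gamma (s : ℝ) : (Real.Gamma s)⁻¹ = s * (Real.Gamma (s + 1))⁻¹ := by
    rcases ne_or_eq s 0 with h | rfl
    · rw [Real.Gamma_add_one h, mul_inv, mul_inv_cancel_left₀ h]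
    · simp [Real.Gamma_zero]
  induction n generalizing a with
  | zero =>
    simp only [zero_add, Finset.range_one, Finset.sum_singleton, Nat.choose_self, Nat.cast_one,
      one_mul, Nat.cast_zero, zero_sub, Nat.factorial_zero, mul_one, add_zero]
    by_cases h : a = 0
    · simp [h, sinOver, Real.Gamma_one]
    · have h2 := Real.Gamma_mul_Gamma_one_sub a
      rw [add_comm 1 a, Real.Gamma_add_one h, mul_inv, mul_assoc, ← mul_inv, h2]
      simp only [sinOver, neg_eq_zero, h, if_false, neg_mul, Real.sin_neg, neg_div_neg_eq]
      rw [mul_comm a Real.pi]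
      have := Real.pi_ne_zero
      rw [inv_div]
      field_simp
  | succ n ih =>
    -- Pascal's rule yields the sums for `a` and `a - 1`. Over a common denominator they carry the
    -- weights `1 + n - a` and `a`, which add up to `n + 1`.
    have key : ∑ k ∈ Finset.range (n + 1 + 1), ((n + 1).choose k : ℝ) * sinOver (k - a) Real.pi =
        (∑ k ∈ Finset.range (n + 1), (n.choose k : ℝ) * sinOver (k - a) Real.pi) +
        ∑ k ∈ Finset.range (n + 1), (n.choose k : ℝ) * sinOver (k - (a - 1)) Real.pi := by
      rw [Finset.sum_range_succ']
      have e1 : ∑ k ∈ Finset.range (n + 1), (n.choose k : ℝ) * sinOver (k - a) Real.pi =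
          ∑ k ∈ Finset.range (n + 1), (n.choose (k + 1) : ℝ) * sinOver ((k + 1 : ℕ) - a) Real.pi +
            sinOver (-a) Real.pi := by
        rw [Finset.sum_range_succ', Finset.sum_range_succ
          (fun k => (n.choose (k + 1) : ℝ) * sinOver ((k + 1 : ℕ) - a) Real.pi)]
        simp
      rw [e1, add_right_comm, ← Finset.sum_add_distrib]
      congr 1
      · refine Finset.sum_congr rfl fun k _ => ?_
        rw [Nat.choose_succ_succ]
        push_cast
        rw [show (k : ℝ) - (a - 1) = k + 1 - a by ring]
        ring
      · simp
    rw [key, ih, ih, inv_Gamma (1 + n - a), show 1 + (a - 1) = a by ring, inv_Gamma a,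
      show 1 + (n : ℝ) - (a - 1) = 1 + n - a + 1 by ring, Nat.factorial_succ]
    push_cast
    rw [show 1 + ((n : ℝ) + 1) - a = 1 + n - a + 1 by ring, add_comm a 1]
    ring

/-- The trigonometric factor of the maximally skewed stable law. -/
def kanter (Δ v : ℝ) : ℝ :=
  Real.sin v / (Real.sin ((1 - Δ) * v) ^ (1 - Δ) * Real.sin (v * Δ) ^ Δ)

lemma measurable_kanter (Δ : ℝ) : Measurable (kanter Δ) := by
  unfold kanter
  fun_prop

variable {Δ v : ℝ}

lemma sin_left_pos (h0 : 0 < Δ) (h1 : Δ < 1) (hv : v ∈ Set.Ioo 0 Real.pi) :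
    0 < Real.sin ((1 - Δ) * v) :=
  Real.sin_pos_of_pos_of_lt_pi (mul_pos (by linarith) hv.1) (by nlinarith [hv.1, hv.2])

lemma sin_right_pos (h0 : 0 < Δ) (h1 : Δ < 1) (hv : v ∈ Set.Ioo 0 Real.pi) :
    0 < Real.sin (v * Δ) :=
  Real.sin_pos_of_pos_of_lt_pi (mul_pos hv.1 h0) (by nlinarith [hv.1, hv.2])

lemma kanter_pos (h0 : 0 < Δ) (h1 : Δ < 1) (hv : v ∈ Set.Ioo 0 Real.pi) : 0 < kanter Δ v := by
  have a := sin_left_pos h0 h1 hv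
  have b := sin_right_pos h0 h1 hv
  have c := Real.sin_pos_of_mem_Ioo hv
  unfold kanter
  positivity

/-- By concavity of the sine, `sin (c v) ≥ c sin v`. -/
lemma mul_sin_le_sin_mul {c : ℝ} (h0 : 0 ≤ c) (h1 : c ≤ 1) (hv : v ∈ Set.Icc 0 Real.pi) :
    c * Real.sin v ≤ Real.sin (c * v) := by
  have := strictConcaveOn_sin_Icc.concaveOn.2 (x := v) (y := 0) hv ⟨le_rfl, Real.pi_pos.le⟩
    h0 (sub_nonneg.2 h1) (by ring)
  simpa using this

/-- The concavity bound is applied to both sines in the denominator; their exponents add up to `1`,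
so `sin v` cancels. The power `1/Δ` of this bound is `1 / radius Δ`. -/
lemma kanter_le (h0 : 0 < Δ) (h1 : Δ < 1) (hv : v ∈ Set.Ioo 0 Real.pi) :
    kanter Δ v ≤ ((1 - Δ) ^ (1 - Δ) * Δ ^ Δ)⁻¹ := by
  have hα : 0 < 1 - Δ := by linarith
  have c := Real.sin_pos_of_mem_Ioo hv
  have hv' : v ∈ Set.Icc 0 Real.pi := ⟨hv.1.le, hv.2.le⟩
  have a := mul_sin_le_sin_mul hα.le (by linarith) hv'
  have b := mul_sin_le_sin_mul h0.le h1.le hv'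
  rw [mul_comm Δ v] at b
  have key : ((1 - Δ) ^ (1 - Δ) * Δ ^ Δ) * Real.sin v ≤
      Real.sin ((1 - Δ) * v) ^ (1 - Δ) * Real.sin (v * Δ) ^ Δ := by
    calc ((1 - Δ) ^ (1 - Δ) * Δ ^ Δ) * Real.sin v
        = ((1 - Δ) * Real.sin v) ^ (1 - Δ) * (Δ * Real.sin v) ^ Δ := by
          rw [Real.mul_rpow hα.le c.le, Real.mul_rpow h0.le c.le]
          have : Real.sin v ^ (1 - Δ) * Real.sin v ^ Δ = Real.sin v := by
            rw [← Real.rpow_add c]; simp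
          linear_combination -((1 - Δ) ^ (1 - Δ) * Δ ^ Δ) * this
      _ ≤ _ := by
          have : 0 ≤ Real.sin ((1 - Δ) * v) ^ (1 - Δ) :=
            Real.rpow_nonneg (le_trans (by positivity) a) _
          gcongr
  have hp : 0 < (1 - Δ) ^ (1 - Δ) * Δ ^ Δ := by positivity
  unfold kanter
  rw [div_le_iff₀ (lt_of_lt_of_le (by positivity) key), inv_mul_eq_div, le_div_iff₀ hp]
  linarith

/-- The curve on which `(1 + z) ^ n / z ^ (n Δ)` is real, in polar coordinates. -/
def curve (Δ v : ℝ) : ℝ := Real.sin (v * Δ) / Real.sin ((1 - Δ) * v)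

lemma curve_pos (h0 : 0 < Δ) (h1 : Δ < 1) (hv : v ∈ Set.Ioo 0 Real.pi) : 0 < curve Δ v :=
  div_pos (sin_right_pos h0 h1 hv) (sin_left_pos h0 h1 hv)

/-- For `z = curve Δ v * exp (i v)` one has `|1 + z| = sin v / sin ((1 - Δ) v)`, so the right side
is the modulus of `(1 + z) ^ n z ^ (-Δn)`. -/
lemma kanter_pow_eq (h0 : 0 < Δ) (h1 : Δ < 1) (hv : v ∈ Set.Ioo 0 Real.pi) (n : ℕ) :
    kanter Δ v ^ n =
      curve Δ v ^ (-(Δ * n)) * (Real.sin v / Real.sin ((1 - Δ) * v)) ^ n := by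
  have a := sin_left_pos h0 h1 hv
  have b := sin_right_pos h0 h1 hv
  rw [← neg_mul, Real.rpow_mul_natCast (curve_pos h0 h1 hv).le, ← mul_pow]
  congr 1
  rw [curve, Real.div_rpow b.le a.le, Real.rpow_neg b.le, Real.rpow_neg a.le, kanter,
    Real.rpow_sub a, Real.rpow_one]
  have : 0 < Real.sin (v * Δ) ^ Δ := by positivity
  have : 0 < Real.sin ((1 - Δ) * v) ^ Δ := by positivity
  field_simp

/-- This is the binomial expansion of `(1 + z) ^ n z ^ (-Δn)` on the curve. There `1 + z` has
argument `Δv`, which cancels the argument of `z ^ (-Δ)`, so the value is real. -/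
lemma sum_choose_cexp (h0 : 0 < Δ) (h1 : Δ < 1) (hv : v ∈ Set.Ioo 0 Real.pi) (n : ℕ) :
    ∑ k ∈ Finset.range (n + 1), (n.choose k : ℂ) * (((curve Δ v) ^ (k - Δ * n) : ℝ) *
      Complex.exp (((k - Δ * n) * v : ℝ) * Complex.I)) = ((kanter Δ v ^ n : ℝ) : ℂ) := by
  have a := sin_left_pos h0 h1 hv
  have hz : 1 + (curve Δ v : ℂ) * Complex.exp (v * Complex.I) =
      (Real.sin v / Real.sin ((1 - Δ) * v) : ℝ) * Complex.exp ((v * Δ : ℝ) * Complex.I) := by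
    have e : Real.sin v = Real.sin ((1 - Δ) * v) * Real.cos (v * Δ) +
        Real.cos ((1 - Δ) * v) * Real.sin (v * Δ) := by
      rw [← Real.sin_add]; ring_nf
    have e' : Real.cos v = Real.cos ((1 - Δ) * v) * Real.cos (v * Δ) -
        Real.sin ((1 - Δ) * v) * Real.sin (v * Δ) := by
      rw [← Real.cos_add]; ring_nf
    apply Complex.ext
    · simp only [Complex.add_re, Complex.one_re, Complex.re_ofReal_mul,
        Complex.exp_ofReal_mul_I_re, curve]
      rw [e, e']
      generalize Real.sin ((1 - Δ) * v) = x at a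
      field_simp
      linear_combination (-x) * Real.sin_sq_add_cos_sq (v * Δ)
    · simp only [Complex.add_im, Complex.one_im, Complex.im_ofReal_mul,
        Complex.exp_ofReal_mul_I_im, curve]
      field_simp
      ring
  have hk (k : ℕ) : (n.choose k : ℂ) * (((curve Δ v) ^ (k - Δ * n) : ℝ) *
      Complex.exp (((k - Δ * n) * v : ℝ) * Complex.I)) =
      ((curve Δ v ^ (-(Δ * n)) : ℝ) * Complex.exp ((-(Δ * n) * v : ℝ) * Complex.I)) *
      (((curve Δ v : ℂ) * Complex.exp (v * Complex.I)) ^ k * 1 ^ (n - k) * (n.choose k : ℂ)) := by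
    rw [sub_eq_neg_add, Real.rpow_add (curve_pos h0 h1 hv), Real.rpow_natCast, mul_pow,
      ← Complex.exp_nat_mul]
    have : (((-(Δ * n) + k) * v : ℝ) : ℂ) * Complex.I =
      ((-(Δ * n) * v : ℝ) : ℂ) * Complex.I + k * (v * Complex.I) := by push_cast; ring
    rw [this, Complex.exp_add]
    push_cast
    ring
  rw [Finset.sum_congr rfl fun k _ => hk k, ← Finset.mul_sum, ← add_pow, add_comm _ (1 : ℂ), hz,
    mul_pow, ← Complex.exp_nat_mul, kanter_pow_eq h0 h1 hv]
  have : Complex.exp ((-(Δ * n) * v : ℝ) * Complex.I) *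
      Complex.exp (n * ((v * Δ : ℝ) * Complex.I)) = 1 := by
    rw [← Complex.exp_add]
    convert Complex.exp_zero using 2
    push_cast; ring
  push_cast at this ⊢
  linear_combination ((curve Δ v ^ (-(Δ * n)) : ℝ) : ℂ) *
    (Complex.sin v / Complex.sin ((1 - Δ) * v)) ^ n * this

/-- A primitive of `kanter Δ ^ n`. -/
def primitive (Δ : ℝ) (n : ℕ) (v : ℝ) : ℝ :=
  ∑ k ∈ Finset.range (n + 1), (n.choose k : ℝ) *
    (curve Δ v ^ (k - Δ * n) * sinOver (k - Δ * n) v)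

/-- With `ρ = curve Δ`, the derivative is the real part of the expansion plus `ρ' / ρ` times its
imaginary part, and the latter vanishes. -/
lemma hasDerivAt_primitive (h0 : 0 < Δ) (h1 : Δ < 1) (hv : v ∈ Set.Ioo 0 Real.pi) (n : ℕ) :
    HasDerivAt (primitive Δ n) (kanter Δ v ^ n) v := by
  have a := sin_left_pos h0 h1 hv
  have hc := curve_pos h0 h1 hv
  obtain ⟨d, hd⟩ : ∃ d, HasDerivAt (curve Δ) d v := by
    have : DifferentiableAt ℝ (curve Δ) v := by
      unfold curve
      exact DifferentiableAt.div (by fun_prop) (by fun_prop) a.ne'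
    exact ⟨_, this.hasDerivAt⟩
  have hre := congrArg Complex.re (sum_choose_cexp h0 h1 hv n)
  have him := congrArg Complex.im (sum_choose_cexp h0 h1 hv n)
  simp only [← Complex.ofReal_natCast, Complex.re_sum, Complex.im_sum, Complex.re_ofReal_mul,
    Complex.im_ofReal_mul, Complex.exp_ofReal_mul_I_re, Complex.exp_ofReal_mul_I_im,
    Complex.ofReal_re, Complex.ofReal_im] at hre him
  have key : HasDerivAt (primitive Δ n) (∑ k ∈ Finset.range (n + 1), (n.choose k : ℝ) *
      (d * (k - Δ * n) * curve Δ v ^ ((k - Δ * n) - 1) * sinOver (k - Δ * n) v +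
        curve Δ v ^ (k - Δ * n) * Real.cos ((k - Δ * n) * v))) v := by
    unfold primitive
    refine HasDerivAt.fun_sum fun k _ => ?_
    refine HasDerivAt.const_mul _ ?_
    exact (hd.rpow_const (Or.inl hc.ne')).mul (hasDerivAt_sinOver _ _)
  convert key using 1
  rw [← hre, ← add_zero (Finset.sum _ _), ← mul_zero (d / curve Δ v), ← him, Finset.mul_sum,
    ← Finset.sum_add_distrib]
  refine Finset.sum_congr rfl fun k _ => ?_
  rw [← mul_sinOver, Real.rpow_sub_one hc.ne']
  ring

/-- At `0` the curve is a quotient `0/0`, so a one-sided limit is needed: it tends to `Δ / (1 - Δ) >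
0`, while the factors `sinOver` vanish. -/
lemma tendsto_primitive_zero (h0 : 0 < Δ) (h1 : Δ < 1) (n : ℕ) :
    Filter.Tendsto (primitive Δ n) (nhdsWithin 0 (Set.Ioi 0)) (nhds 0) := by
  have hα : 0 < 1 - Δ := by linarith
  have slope (c : ℝ) (f : ℝ → ℝ) (hf : HasDerivAt f c 0) (hf0 : f 0 = 0) :
      Filter.Tendsto (fun x => f x / x) (nhdsWithin 0 (Set.Ioi 0)) (nhds c) := by
    have := hf.tendsto_slope_zero_right
    simpa [hf0, div_eq_inv_mul] using this
  have d1 : HasDerivAt (fun v : ℝ => Real.sin (v * Δ)) Δ 0 := by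
    have := ((hasDerivAt_id (0 : ℝ)).mul_const Δ).sin
    simpa using this
  have d2 : HasDerivAt (fun v : ℝ => Real.sin ((1 - Δ) * v)) (1 - Δ) 0 := by
    have := ((hasDerivAt_id (0 : ℝ)).const_mul (1 - Δ)).sin
    simpa using this
  have hc : Filter.Tendsto (curve Δ) (nhdsWithin 0 (Set.Ioi 0)) (nhds (Δ / (1 - Δ))) := by
    refine ((slope _ _ d1 (by simp)).div (slope _ _ d2 (by simp)) hα.ne').congr' ?_
    filter_upwards [self_mem_nhdsWithin] with x (hx : 0 < x)
    simp only [Pi.div_apply, curve]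
    field_simp
  have : (0 : ℝ) = ∑ k ∈ Finset.range (n + 1), (n.choose k : ℝ) *
      ((Δ / (1 - Δ)) ^ ((k : ℝ) - Δ * n) * 0) := by simp
  rw [show nhds (0 : ℝ) = nhds _ from congrArg nhds this]
  unfold primitive
  refine tendsto_finsetSum _ fun k _ => Filter.Tendsto.const_mul _ (Filter.Tendsto.mul ?_ ?_)
  · exact hc.rpow_const (Or.inl (by positivity))
  · have := (hasDerivAt_sinOver (k - Δ * n) 0).continuousAt.tendsto
    rw [show sinOver (k - Δ * n) 0 = 0 by simp [sinOver]] at this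
    exact this.mono_left nhdsWithin_le_nhds

lemma tendsto_primitive_pi (h0 : 0 < Δ) (h1 : Δ < 1) (n : ℕ) :
    Filter.Tendsto (primitive Δ n) (nhdsWithin Real.pi (Set.Iio Real.pi))
      (nhds (∑ k ∈ Finset.range (n + 1), (n.choose k : ℝ) * sinOver (k - Δ * n) Real.pi)) := by
  have e : Real.sin ((1 - Δ) * Real.pi) = Real.sin (Real.pi * Δ) := by
    rw [← Real.sin_pi_sub]; ring_nf
  have a : 0 < Real.sin (Real.pi * Δ) :=
    Real.sin_pos_of_pos_of_lt_pi (by positivity) (by nlinarith [Real.pi_pos])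
  have hc1 : curve Δ Real.pi = 1 := by rw [curve, e, div_self a.ne']
  have hc : ContinuousAt (curve Δ) Real.pi := by
    unfold curve
    exact ContinuousAt.div (by fun_prop) (by fun_prop) (by rw [e]; exact a.ne')
  have : ContinuousAt (primitive Δ n) Real.pi := by
    unfold primitive
    refine tendsto_finsetSum _ fun k _ => Filter.Tendsto.const_mul _ (Filter.Tendsto.mul ?_ ?_)
    · exact hc.tendsto.rpow_const (Or.inl (by simp [hc1]))
    · exact (hasDerivAt_sinOver _ _).continuousAt
  have h := this.tendsto.mono_left (nhdsWithin_le_nhds (s := Set.Iio Real.pi))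
  simpa [primitive, hc1] using h

lemma integrableOn_kanter_pow (h0 : 0 < Δ) (h1 : Δ < 1) (n : ℕ) :
    IntegrableOn (fun v => kanter Δ v ^ n) (Set.Ioo 0 Real.pi) := by
  refine Measure.integrableOn_of_bounded (M := (((1 - Δ) ^ (1 - Δ) * Δ ^ Δ)⁻¹) ^ n) (by simp)
    ((measurable_kanter Δ).pow_const n).aestronglyMeasurable ?_
  filter_upwards [ae_restrict_mem measurableSet_Ioo] with v hv
  have := (kanter_pos h0 h1 hv).le
  rw [Real.norm_of_nonneg (by positivity)]
  exact pow_le_pow_left₀ this (kanter_le h0 h1 hv) n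

theorem integral_kanter_pow (h0 : 0 < Δ) (h1 : Δ < 1) (n : ℕ) :
    ∫ v in Set.Ioo 0 Real.pi, kanter Δ v ^ n =
      Real.pi * n.factorial *
        ((Real.Gamma (1 + Δ * n))⁻¹ * (Real.Gamma (1 + (1 - Δ) * n))⁻¹) := by
  rw [← integral_Ioc_eq_integral_Ioo, ← intervalIntegral.integral_of_le Real.pi_pos.le,
    intervalIntegral.integral_eq_sub_of_hasDerivAt_of_tendsto Real.pi_pos
      (fun v hv => hasDerivAt_primitive h0 h1 hv n) ?_ (tendsto_primitive_zero h0 h1 n)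
      (tendsto_primitive_pi h0 h1 n), sub_zero, sum_choose_sinOver_pi]
  · ring_nf
  · rw [intervalIntegrable_iff_integrableOn_Ioo_of_le Real.pi_pos.le]
    exact integrableOn_kanter_pow h0 h1 n

end

section

/-! ### Measures on the half-line determined by their moments -/

section Moments

variable {Ω : Type*} [MeasurableSpace Ω] {P : Measure Ω}

/-- Termwise integration of the exponential series against a nonnegative weight. -/
lemma hasSum_integral_mul_exp {g X : Ω → ℝ} (hgm : AEStronglyMeasurable g P)
    (hXm : AEStronglyMeasurable X P) (hg : ∀ᵐ ω ∂P, 0 ≤ g ω) (hX : ∀ᵐ ω ∂P, 0 ≤ X ω) {t : ℝ}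
    (hint : Integrable (fun ω => g ω * Real.exp (|t| * X ω)) P) :
    HasSum (fun n : ℕ => t ^ n / (n.factorial : ℝ) * ∫ ω, g ω * X ω ^ n ∂P)
      (∫ ω, g ω * Real.exp (t * X ω) ∂P) := by
  have hexp (x : ℝ) : HasSum (fun n : ℕ => x ^ n / (n.factorial : ℝ)) (Real.exp x) := by
    rw [Real.exp_eq_exp_ℝ]
    exact NormedSpace.expSeries_div_hasSum_exp x
  have := hasSum_integral_of_dominated_convergence (μ := P)
    (F := fun (n : ℕ) ω => t ^ n / (n.factorial : ℝ) * (g ω * X ω ^ n))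
    (f := fun ω => g ω * Real.exp (t * X ω))
    (fun (n : ℕ) ω => g ω * ((|t| * X ω) ^ n / (n.factorial : ℝ)))
    (fun n => by fun_prop) ?_ ?_ ?_ ?_
  · simpa only [integral_const_mul] using this
  · intro n
    filter_upwards [hg, hX] with ω h1 h2
    rw [Real.norm_eq_abs, abs_mul, abs_div, abs_pow, abs_of_nonneg (mul_nonneg h1 (pow_nonneg h2 n)),
      Nat.abs_cast, mul_pow]
    apply le_of_eq
    ring
  · exact .of_forall fun ω => ((hexp _).mul_left _).summable
  · simpa only [((hexp _).mul_left _).tsum_eq] using hint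
  · refine .of_forall fun ω => ?_
    rw [show (fun n : ℕ => t ^ n / (n.factorial : ℝ) * (g ω * X ω ^ n)) =
      fun n => g ω * ((t * X ω) ^ n / n.factorial) from funext fun n => by rw [mul_pow]; ring]
    exact (hexp (t * X ω)).mul_left (g ω)

/-- Stated for the Lebesgue integral, this needs no integrability, so finiteness of an exponential
moment can be read off from the moments alone. -/
lemma lintegral_exp_eq_tsum {X : Ω → ℝ} (hXm : AEMeasurable X P) (hX : ∀ᵐ ω ∂P, 0 ≤ X ω) {s : ℝ}
    (hs : 0 ≤ s) :
    ∫⁻ ω, ENNReal.ofReal (Real.exp (s * X ω)) ∂P = ∑' n : ℕ,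
      ENNReal.ofReal (s ^ n / (n.factorial : ℝ)) * ∫⁻ ω, ENNReal.ofReal (X ω ^ n) ∂P := by
  have h (n : ℕ) : AEMeasurable (fun ω => ENNReal.ofReal (X ω ^ n)) P := by fun_prop
  simp_rw [← lintegral_const_mul'' _ (h _)]
  rw [← lintegral_tsum fun n => (h n).const_mul _]
  refine lintegral_congr_ae ?_
  filter_upwards [hX] with ω h2
  have he : HasSum (fun n : ℕ => (s * X ω) ^ n / (n.factorial : ℝ)) (Real.exp (s * X ω)) := by
    rw [Real.exp_eq_exp_ℝ]
    exact NormedSpace.expSeries_div_hasSum_exp _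
  rw [← he.tsum_eq, ENNReal.ofReal_tsum_of_nonneg (fun n => by positivity) he.summable]
  refine tsum_congr fun n => ?_
  rw [← ENNReal.ofReal_mul (by positivity), mul_pow]
  congr 1
  ring

/-- Two probability measures on the half-line with the same moments, one of which has an
exponential moment, are equal. -/
theorem measure_ext_of_moments {μ ν : Measure ℝ} [IsProbabilityMeasure μ] [IsProbabilityMeasure ν]
    (hμ : ∀ᵐ x ∂μ, 0 ≤ x) (hν : ∀ᵐ x ∂ν, 0 ≤ x)
    (hm : ∀ n : ℕ, ∫⁻ x, ENNReal.ofReal (x ^ n) ∂μ = ∫⁻ x, ENNReal.ofReal (x ^ n) ∂ν)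
    {s : ℝ} (hs : 0 < s) (hint : Integrable (fun x => Real.exp (s * x)) ν) : μ = ν := by
  have hint' : Integrable (fun x => Real.exp (s * x)) μ := by
    refine ⟨by fun_prop, ?_⟩
    have h := hint.2
    rw [hasFiniteIntegral_iff_ofReal (.of_forall fun x => (Real.exp_pos _).le)] at h ⊢
    rw [lintegral_exp_eq_tsum aemeasurable_id' hμ hs.le]
    rw [lintegral_exp_eq_tsum aemeasurable_id' hν hs.le] at h
    simpa only [hm] using h
  have hI (κ : Measure ℝ) [IsProbabilityMeasure κ] (hκ : ∀ᵐ x ∂κ, 0 ≤ x)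
      (h : Integrable (fun x => Real.exp (s * x)) κ) (t : ℝ) (ht : t ≤ s) :
      Integrable (fun x => Real.exp (t * x)) κ := by
    refine h.mono' (by fun_prop) ?_
    filter_upwards [hκ] with x hx
    rw [Real.norm_of_nonneg (Real.exp_pos _).le]
    gcongr
  have hset (κ : Measure ℝ) [IsProbabilityMeasure κ] (hκ : ∀ᵐ x ∂κ, 0 ≤ x)
      (h : Integrable (fun x => Real.exp (s * x)) κ) :
      Set.Iio s ⊆ interior (integrableExpSet id κ) :=
    interior_maximal (fun t ht => hI κ hκ h t (le_of_lt ht)) isOpen_Iio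
  have hreal (t : ℝ) (ht : |t| < s) : mgf id μ t = mgf id ν t := by
    have h1 := hasSum_integral_mul_exp (P := μ) (g := fun _ => 1) (X := id) (t := t) (by fun_prop)
      (by fun_prop) (.of_forall fun _ => zero_le_one) hμ (by simpa using hI μ hμ hint' _ ht.le)
    have h2 := hasSum_integral_mul_exp (P := ν) (g := fun _ => 1) (X := id) (t := t) (by fun_prop)
      (by fun_prop) (.of_forall fun _ => zero_le_one) hν (by simpa using hI ν hν hint _ ht.le)
    have e (n : ℕ) : ∫ x, id x ^ n ∂μ = ∫ x, id x ^ n ∂ν := by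
      rw [integral_eq_lintegral_of_nonneg_ae _ (by fun_prop),
        integral_eq_lintegral_of_nonneg_ae _ (by fun_prop)]
      · simp only [id, hm]
      · filter_upwards [hν] with x hx using pow_nonneg hx n
      · filter_upwards [hμ] with x hx using pow_nonneg hx n
    simp only [one_mul, e] at h1 h2
    exact h1.unique h2
  -- Both transforms are analytic on the half-plane `re z < s` and agree at real points accumulating
  -- at `0`. The half-plane contains the imaginary axis, where they are the characteristic
  -- functions.
  have hstrip : Set.EqOn (complexMGF id μ) (complexMGF id ν) {z | z.re ∈ Set.Iio s} := by
    have hX : AnalyticOnNhd ℂ (complexMGF id μ) {z | z.re ∈ Set.Iio s} :=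
      analyticOnNhd_complexMGF.mono fun z hz => hset μ hμ hint' hz
    have hY : AnalyticOnNhd ℂ (complexMGF id ν) {z | z.re ∈ Set.Iio s} :=
      analyticOnNhd_complexMGF.mono fun z hz => hset ν hν hint hz
    refine AnalyticOnNhd.eqOn_of_preconnected_of_frequently_eq hX hY
      ((convex_Iio s).linear_preimage Complex.reLm).isPreconnected (z₀ := ((0 : ℝ) : ℂ))
      (by simpa using hs) ?_
    have hev : ∀ᶠ x : ℝ in nhdsWithin 0 (Set.Ioi 0), complexMGF id μ x = complexMGF id ν x := by
      have : ∀ᶠ x : ℝ in nhdsWithin 0 (Set.Ioi 0), |x| < s :=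
        nhdsWithin_le_nhds ((continuous_abs.tendsto (0 : ℝ)).eventually_lt_const (by simpa using hs))
      filter_upwards [this] with x hx
      rw [complexMGF_ofReal, complexMGF_ofReal, hreal x hx]
    refine Filter.Tendsto.frequently (f := fun x : ℝ => (x : ℂ)) ?_ hev.frequently
    refine tendsto_nhdsWithin_iff.2 ⟨?_, ?_⟩
    · exact (Complex.continuous_ofReal.tendsto 0).mono_left nhdsWithin_le_nhds
    · filter_upwards [self_mem_nhdsWithin] with x (hx : 0 < x)
      simpa using hx.ne'
  refine Measure.ext_of_charFun ?_
  ext t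
  rw [← complexMGF_id_mul_I, ← complexMGF_id_mul_I]
  exact hstrip (by simpa using hs)

end Moments

/-! ### The exponential law -/

/-- A nonnegative function whose Bochner integral is positive is integrable. -/
lemma lintegral_ofReal_of_integral_eq {Ω : Type*} [MeasurableSpace Ω] {P : Measure Ω} {f : Ω → ℝ}
    {c : ℝ} (hf : 0 ≤ᵐ[P] f) (h : ∫ ω, f ω ∂P = c) (hc : 0 < c) :
    ∫⁻ ω, ENNReal.ofReal (f ω) ∂P = ENNReal.ofReal c := by
  rw [← h, ofReal_integral_eq_lintegral_ofReal _ hf]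
  by_contra hn
  rw [integral_undef hn] at h
  exact hc.ne h

instance : IsProbabilityMeasure (expMeasure 1) := isProbabilityMeasure_expMeasure one_pos

instance : IsProbabilityMeasure uniformLaw :=
  cond_isProbabilityMeasure_of_finite (by simp [Real.pi_pos]) (by simp)

lemma expMeasure_one : expMeasure 1 =
    (volume.restrict (Set.Ioi 0)).withDensity fun x => ENNReal.ofReal (Real.exp (-x)) := by
  rw [expMeasure, gammaMeasure, ← withDensity_indicator measurableSet_Ioi]
  refine withDensity_congr_ae ?_
  filter_upwards [Measure.ae_ne volume (0 : ℝ)] with x hx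
  rcases lt_or_gt_of_ne hx with h | h
  · rw [gammaPDF_of_neg h, Set.indicator_of_notMem (by simpa using h.le)]
  · rw [gammaPDF_of_nonneg h.le, Set.indicator_of_mem (by simpa using h)]
    simp

lemma ae_expMeasure_pos : ∀ᵐ x ∂expMeasure 1, 0 < x := by
  rw [expMeasure_one]
  exact (withDensity_absolutelyContinuous _ _).ae_le (ae_restrict_mem measurableSet_Ioi)

lemma lintegral_rpow_mul_exp_expMeasure {p s : ℝ} (hp : -1 < p) (hs : s < 1) :
    ∫⁻ x, ENNReal.ofReal (x ^ p * Real.exp (s * x)) ∂expMeasure 1 =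
      ENNReal.ofReal ((1 / (1 - s)) ^ (p + 1) * Real.Gamma (p + 1)) := by
  have hs' : 0 < 1 - s := by linarith
  have hg := Real.Gamma_pos_of_pos (show 0 < p + 1 by linarith)
  rw [expMeasure_one, lintegral_withDensity_eq_lintegral_mul _ (by fun_prop) (by fun_prop),
    ← lintegral_ofReal_of_integral_eq _ (Real.integral_rpow_mul_exp_neg_mul_Ioi (a := p + 1)
      (r := 1 - s) (by linarith) hs') (by positivity)]
  · refine setLIntegral_congr_fun measurableSet_Ioi fun x hx => ?_
    simp only [Pi.mul_apply]
    rw [← ENNReal.ofReal_mul (Real.exp_pos _).le, mul_left_comm, ← Real.exp_add]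
    ring_nf
  · filter_upwards [ae_restrict_mem measurableSet_Ioi] with x (hx : 0 < x)
    simp only [Pi.zero_apply]
    positivity

lemma lintegral_rpow_expMeasure {p : ℝ} (hp : -1 < p) :
    ∫⁻ x, ENNReal.ofReal (x ^ p) ∂expMeasure 1 = ENNReal.ofReal (Real.Gamma (1 + p)) := by
  simpa [add_comm] using lintegral_rpow_mul_exp_expMeasure hp zero_lt_one

lemma lintegral_exp_expMeasure {s : ℝ} (hs : s < 1) :
    ∫⁻ x, ENNReal.ofReal (Real.exp (s * x)) ∂expMeasure 1 = ENNReal.ofReal (1 / (1 - s)) := by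
  simpa using lintegral_rpow_mul_exp_expMeasure (p := 0) (by norm_num) hs

lemma expMeasure_Ioi {x : ℝ} (hx : 0 ≤ x) :
    expMeasure 1 (Set.Ioi x) = ENNReal.ofReal (Real.exp (-x)) := by
  have h := cdf_expMeasure_eq one_pos x
  rw [cdf_eq_real, if_pos hx] at h
  have h2 := probReal_compl_eq_one_sub (μ := expMeasure 1) (measurableSet_Iic (a := x))
  rw [h, Set.compl_Iic] at h2
  rw [← ofReal_measureReal, h2]
  simp

/-! ### The uniform law -/

lemma lintegral_uniformLaw (f : ℝ → ENNReal) :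
    ∫⁻ v, f v ∂uniformLaw = ENNReal.ofReal Real.pi⁻¹ * ∫⁻ v in Set.Ioo 0 Real.pi, f v := by
  rw [uniformLaw, ProbabilityTheory.cond, lintegral_smul_measure, Real.volume_Ioo, sub_zero,
    ENNReal.ofReal_inv_of_pos Real.pi_pos, smul_eq_mul]

lemma ae_uniformLaw_mem : ∀ᵐ v ∂uniformLaw, v ∈ Set.Ioo 0 Real.pi :=
  ae_cond_mem measurableSet_Ioo

lemma lintegral_kanter_pow {Δ : ℝ} (h0 : 0 < Δ) (h1 : Δ < 1) (n : ℕ) :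
    ∫⁻ v, ENNReal.ofReal (kanter Δ v ^ n) ∂uniformLaw = ENNReal.ofReal (n.factorial *
        ((Real.Gamma (1 + Δ * n))⁻¹ * (Real.Gamma (1 + (1 - Δ) * n))⁻¹)) := by
  rw [lintegral_uniformLaw, ← ofReal_integral_eq_lintegral_ofReal (integrableOn_kanter_pow h0 h1 n),
    integral_kanter_pow h0 h1, ← ENNReal.ofReal_mul (by positivity)]
  · congr 1
    have := Real.pi_ne_zero
    field_simp
  · filter_upwards [ae_restrict_mem measurableSet_Ioo] with v hv
    exact pow_nonneg (kanter_pos h0 h1 hv).le n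

end

section

/-! ### The Laplace transform of the stable law -/

/-- The joint law of the pair `(v, w)`. -/
abbrev sourceLaw : Measure (ℝ × ℝ) := uniformLaw.prod (expMeasure 1)

lemma ae_sourceLaw : ∀ᵐ p ∂sourceLaw, p.1 ∈ Set.Ioo 0 Real.pi ∧ 0 < p.2 :=
  (Measure.quasiMeasurePreserving_fst.ae ae_uniformLaw_mem).and
    (Measure.quasiMeasurePreserving_snd.ae ae_expMeasure_pos)

lemma measurable_stableGen (Δ : ℝ) : Measurable fun p : ℝ × ℝ => stableGen Δ p.1 p.2 := by
  unfold stableGen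
  fun_prop

variable {Δ v w : ℝ}

lemma stableGen_eq (h0 : 0 < Δ) (h1 : Δ < 1) (hv : v ∈ Set.Ioo 0 Real.pi) (hw : 0 < w) :
    stableGen Δ v w = (w ^ Δ * kanter Δ v) ^ (-(1 - Δ)⁻¹) := by
  have hα : 0 < 1 - Δ := by linarith
  have a := sin_left_pos h0 h1 hv
  have b := sin_right_pos h0 h1 hv
  have c := Real.sin_pos_of_mem_Ioo hv
  have hk := kanter_pos h0 h1 hv
  apply Real.log_injOn_pos
  · unfold stableGen
    simp only [Set.mem_Ioi]
    positivity
  · simp only [Set.mem_Ioi]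
    positivity
  unfold stableGen kanter
  rw [Real.log_mul (by positivity) (by positivity), Real.log_div (by positivity) (by positivity),
    Real.log_rpow c, Real.log_rpow (by positivity), Real.log_div (by positivity) (by positivity),
    Real.log_rpow (by positivity), Real.log_mul (by positivity) (by positivity), Real.log_rpow hw,
    Real.log_div (by positivity) (by positivity), Real.log_mul (by positivity) (by positivity),
    Real.log_rpow a, Real.log_rpow b]
  field_simp
  ring

lemma stableGen_pos (h0 : 0 < Δ) (h1 : Δ < 1) (hv : v ∈ Set.Ioo 0 Real.pi) (hw : 0 < w) :
    0 < stableGen Δ v w := by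
  have hk := kanter_pos h0 h1 hv
  rw [stableGen_eq h0 h1 hv hw]
  positivity

/-- The product `T ^ α * W ^ Δ * C(V)`, where `T` and `W` are exponential and `V` is uniform. -/
def mixture (Δ : ℝ) (z : (ℝ × ℝ) × ℝ) : ℝ := z.2 ^ (1 - Δ) * (z.1.2 ^ Δ * kanter Δ z.1.1)

lemma measurable_mixture (Δ : ℝ) : Measurable (mixture Δ) := by
  have := (measurable_kanter Δ).comp (measurable_fst.comp measurable_fst : Measurable
    fun z : (ℝ × ℝ) × ℝ => z.1.1)
  unfold mixture
  exact (measurable_snd.pow_const _).mul (((measurable_snd.comp measurable_fst).pow_const _).mul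
    this)

lemma ae_prod_expMeasure : ∀ᵐ z ∂sourceLaw.prod (expMeasure 1),
    (z.1.1 ∈ Set.Ioo 0 Real.pi ∧ 0 < z.1.2) ∧ 0 < z.2 :=
  (Measure.quasiMeasurePreserving_fst.ae ae_sourceLaw).and
    (Measure.quasiMeasurePreserving_snd.ae ae_expMeasure_pos)

lemma lintegral_mixture_pow (h0 : 0 < Δ) (h1 : Δ < 1) (n : ℕ) :
    ∫⁻ z, ENNReal.ofReal (mixture Δ z ^ n) ∂sourceLaw.prod (expMeasure 1) =
      ENNReal.ofReal n.factorial := by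
  have hα : 0 < 1 - Δ := by linarith
  have e : ∀ᵐ z ∂sourceLaw.prod (expMeasure 1), ENNReal.ofReal (mixture Δ z ^ n) =
      (ENNReal.ofReal (kanter Δ z.1.1 ^ n) * ENNReal.ofReal (z.1.2 ^ (Δ * n))) *
        ENNReal.ofReal (z.2 ^ ((1 - Δ) * n)) := by
    filter_upwards [ae_prod_expMeasure] with z ⟨⟨hv, hw⟩, ht⟩
    have hk := kanter_pos h0 h1 hv
    rw [← ENNReal.ofReal_mul (by positivity), ← ENNReal.ofReal_mul (by positivity), mixture,
      mul_pow, mul_pow, Real.rpow_mul_natCast hw.le, Real.rpow_mul_natCast ht.le]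
    congr 1
    ring
  have m1 : Measurable fun v => ENNReal.ofReal (kanter Δ v ^ n) :=
    ((measurable_kanter Δ).pow_const n).ennreal_ofReal
  have m2 (c : ℝ) : Measurable fun w : ℝ => ENNReal.ofReal (w ^ c) := by fun_prop
  rw [lintegral_congr_ae e, lintegral_prod_mul (f := fun p : ℝ × ℝ =>
      ENNReal.ofReal (kanter Δ p.1 ^ n) * ENNReal.ofReal (p.2 ^ (Δ * n)))
      (g := fun t => ENNReal.ofReal (t ^ ((1 - Δ) * n)))
      ((m1.comp measurable_fst).mul ((m2 _).comp measurable_snd)).aemeasurable (m2 _).aemeasurable,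
    lintegral_prod_mul (f := fun v => ENNReal.ofReal (kanter Δ v ^ n))
      (g := fun w => ENNReal.ofReal (w ^ (Δ * n))) m1.aemeasurable (m2 _).aemeasurable,
    lintegral_kanter_pow h0 h1, lintegral_rpow_expMeasure, lintegral_rpow_expMeasure]
  · have g1 := Real.Gamma_pos_of_pos (show 0 < 1 + Δ * n by positivity)
    have g2 := Real.Gamma_pos_of_pos (show 0 < 1 + (1 - Δ) * n by positivity)
    rw [← ENNReal.ofReal_mul (by positivity), ← ENNReal.ofReal_mul (by positivity)]
    congr 1
    field_simp
  · have : 0 ≤ (1 - Δ) * n := by positivity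
    linarith
  · have : 0 ≤ Δ * n := by positivity
    linarith

/-- The moments of the three independent factors multiply to `n!`: the Gamma factors of the two
exponentials cancel those in the moments of `kanter`. -/
lemma map_mixture (h0 : 0 < Δ) (h1 : Δ < 1) :
    (sourceLaw.prod (expMeasure 1)).map (mixture Δ) = expMeasure 1 := by
  have hm := measurable_mixture Δ
  have : IsProbabilityMeasure ((sourceLaw.prod (expMeasure 1)).map (mixture Δ)) :=
    Measure.isProbabilityMeasure_map hm.aemeasurable
  refine measure_ext_of_moments ?_ ?_ (fun n => ?_) (s := 1 / 2) (by norm_num) ⟨by fun_prop, ?_⟩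
  · rw [ae_map_iff hm.aemeasurable measurableSet_Ici]
    filter_upwards [ae_prod_expMeasure] with z ⟨⟨hv, hw⟩, ht⟩
    have hk := kanter_pos h0 h1 hv
    unfold mixture
    positivity
  · filter_upwards [ae_expMeasure_pos] with x hx using hx.le
  · rw [lintegral_map (by fun_prop) hm, lintegral_mixture_pow h0 h1]
    have := lintegral_rpow_expMeasure (p := n) (lt_of_lt_of_le (by norm_num) n.cast_nonneg)
    rw [add_comm, Real.Gamma_nat_eq_factorial] at this
    simpa using this.symm
  · rw [hasFiniteIntegral_iff_ofReal (.of_forall fun x => (Real.exp_pos _).le),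
      lintegral_exp_expMeasure (by norm_num)]
    exact ENNReal.ofReal_lt_top

/-- The Laplace transform of the maximally skewed stable law. -/
theorem lintegral_exp_neg_stableGen (h0 : 0 < Δ) (h1 : Δ < 1) {l : ℝ} (hl : 0 ≤ l) :
    ∫⁻ p, ENNReal.ofReal (Real.exp (-(l * stableGen Δ p.1 p.2))) ∂sourceLaw =
      ENNReal.ofReal (Real.exp (-l ^ (1 - Δ))) := by
  have hα : 0 < 1 - Δ := by linarith
  have hm := measurable_mixture Δ
  -- The right side becomes the probability that the mixture exceeds `l ^ (1 - Δ)`, to be computed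
  -- conditionally on `(v, w)`. Given these, the event is that the remaining exponential variable
  -- exceeds `l * stableGen Δ v w`.
  rw [← expMeasure_Ioi (Real.rpow_nonneg hl _)]
  nth_rewrite 1 [← map_mixture h0 h1]
  rw [Measure.map_apply hm measurableSet_Ioi, Measure.prod_apply (hm measurableSet_Ioi)]
  refine lintegral_congr_ae ?_
  filter_upwards [ae_sourceLaw] with p ⟨hv, hw⟩
  have hr := stableGen_pos h0 h1 hv hw
  rw [← expMeasure_Ioi (by positivity)]
  refine measure_congr ?_
  filter_upwards [ae_expMeasure_pos] with t ht
  have hk : 0 < p.2 ^ Δ * kanter Δ p.1 := mul_pos (Real.rpow_pos_of_pos hw _) (kanter_pos h0 h1 hv)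
  have hc : stableGen Δ p.1 p.2 ^ (1 - Δ) = (p.2 ^ Δ * kanter Δ p.1)⁻¹ := by
    rw [stableGen_eq h0 h1 hv hw, ← Real.rpow_mul hk.le, neg_mul, inv_mul_cancel₀ hα.ne',
      Real.rpow_neg_one]
  apply propext
  change l * stableGen Δ p.1 p.2 < t ↔ l ^ (1 - Δ) < t ^ (1 - Δ) * (p.2 ^ Δ * kanter Δ p.1)
  rw [← Real.rpow_lt_rpow_iff (by positivity) ht.le hα, Real.mul_rpow hl hr.le, hc,
    mul_inv_lt_iff₀ hk]

end

section

/-! ### Negative moments -/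

variable {Δ : ℝ}

/-- Negative moments of a positive law whose Laplace transform is `exp (-F l ^ α)`. -/
lemma lintegral_rpow_neg_of_laplace {κ : Measure ℝ} [IsProbabilityMeasure κ] {a F q : ℝ}
    (ha : 0 < a) (hF : 0 < F) (hq : 0 < q) (hκ : ∀ᵐ x ∂κ, 0 < x)
    (hL : ∀ l : ℝ, 0 < l → ∫⁻ x, ENNReal.ofReal (Real.exp (-(l * x))) ∂κ =
      ENNReal.ofReal (Real.exp (-F * l ^ a))) :
    ∫⁻ x, ENNReal.ofReal (x ^ (-q)) ∂κ =
      ENNReal.ofReal (Real.Gamma (1 + q / a) / Real.Gamma (1 + q) * F ^ (-(q / a))) := by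
  have g1 := Real.Gamma_pos_of_pos hq
  have g2 := Real.Gamma_pos_of_pos (div_pos hq ha)
  -- The Gamma integral `x ^ (-q) Γ(q) = ∫ l ^ (q - 1) exp (-x l) dl`, followed by Tonelli, brings
  -- in the Laplace transform.
  have h1 : (∫⁻ x, ENNReal.ofReal (x ^ (-q)) ∂κ) * ENNReal.ofReal (Real.Gamma q) =
      ∫⁻ x, (∫⁻ l in Set.Ioi (0 : ℝ), ENNReal.ofReal (l ^ (q - 1) * Real.exp (-(x * l)))) ∂κ := by
    rw [← lintegral_mul_const _ (by fun_prop)]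
    refine lintegral_congr_ae ?_
    filter_upwards [hκ] with x hx
    rw [lintegral_ofReal_of_integral_eq _ (Real.integral_rpow_mul_exp_neg_mul_Ioi hq hx)
      (by positivity), ← ENNReal.ofReal_mul (by positivity), one_div, Real.inv_rpow hx.le,
      Real.rpow_neg hx.le]
    filter_upwards [ae_restrict_mem measurableSet_Ioi] with l (hl : 0 < l)
    simp only [Pi.zero_apply]
    positivity
  have h2 : ∫⁻ x, (∫⁻ l in Set.Ioi (0 : ℝ), ENNReal.ofReal (l ^ (q - 1) * Real.exp (-(x * l)))) ∂κ =
      ENNReal.ofReal (F ^ (-(q / a)) * (1 / a) * Real.Gamma (q / a)) := by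
    rw [lintegral_lintegral_swap (by fun_prop)]
    have h := integral_rpow_mul_exp_neg_mul_rpow (p := a) (q := q - 1) (b := F) ha
      (by linarith) hF
    rw [show -(q - 1 + 1) / a = -(q / a) by ring, show q - 1 + 1 = q by ring] at h
    rw [← lintegral_ofReal_of_integral_eq _ h (by positivity)]
    · refine setLIntegral_congr_fun measurableSet_Ioi fun l (hl : 0 < l) => ?_
      have hp : 0 ≤ l ^ (q - 1) := by positivity
      simp_rw [ENNReal.ofReal_mul hp, mul_comm _ l]
      rw [lintegral_const_mul _ (by fun_prop), hL l hl]
    · filter_upwards [ae_restrict_mem measurableSet_Ioi] with l (hl : 0 < l)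
      simp only [Pi.zero_apply]
      positivity
  rw [h2] at h1
  have h3 : ENNReal.ofReal (Real.Gamma q) ≠ 0 := by simpa using g1
  rw [(ENNReal.eq_div_iff h3 ENNReal.ofReal_ne_top).2 ((mul_comm _ _).trans h1),
    ← ENNReal.ofReal_div_of_pos g1]
  congr 1
  rw [add_comm 1, add_comm 1, Real.Gamma_add_one (by positivity), Real.Gamma_add_one hq.ne']
  field_simp

lemma gammaRatio_nonneg (h0 : 0 < Δ) (h1 : Δ < 1) (n : ℕ) : 0 ≤ gammaRatio Δ n := by
  have : 0 < 1 - Δ := by linarith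
  exact div_nonneg (Real.Gamma_pos_of_pos (by positivity)).le
    (Real.Gamma_pos_of_pos (by positivity)).le

/-- The negative moment of order `q = nα/Δ` scales as `F ^ (-n/Δ)`, which the normalisation cancels:
the result is independent of `F`. The case `n = 0` is separate because the formula requires `q > 0`.
-/
lemma lintegral_pow_of_laplace (h0 : 0 < Δ) (h1 : Δ < 1) {κ : Measure ℝ} [IsProbabilityMeasure κ]
    {F : ℝ} (hF : 0 < F) (hκ : ∀ᵐ x ∂κ, 0 < x)
    (hL : ∀ l : ℝ, 0 < l → ∫⁻ x, ENNReal.ofReal (Real.exp (-(l * x))) ∂κ =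
      ENNReal.ofReal (Real.exp (-F * l ^ (1 - Δ)))) (n : ℕ) :
    ∫⁻ x, ENNReal.ofReal ((F ^ (1 / Δ) * x ^ (-(1 - Δ) / Δ)) ^ n) ∂κ =
      ENNReal.ofReal (gammaRatio Δ n) := by
  have hα : 0 < 1 - Δ := by linarith
  rcases Nat.eq_zero_or_pos n with rfl | hn
  · simp [gammaRatio]
  have hn' : (0 : ℝ) < n := by exact_mod_cast hn
  have h := lintegral_rpow_neg_of_laplace (q := n * (1 - Δ) / Δ) hα hF (by positivity) hκ hL
  rw [show (n : ℝ) * (1 - Δ) / Δ / (1 - Δ) = n / Δ by field_simp] at h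
  have e : ∀ᵐ x ∂κ, ENNReal.ofReal ((F ^ (1 / Δ) * x ^ (-(1 - Δ) / Δ)) ^ n) =
      ENNReal.ofReal (F ^ (n / Δ)) * ENNReal.ofReal (x ^ (-(n * (1 - Δ) / Δ))) := by
    filter_upwards [hκ] with x hx
    rw [← ENNReal.ofReal_mul (by positivity), mul_pow, ← Real.rpow_mul_natCast hF.le,
      ← Real.rpow_mul_natCast hx.le]
    ring_nf
  rw [lintegral_congr_ae e, lintegral_const_mul _ (by fun_prop), h,
    ← ENNReal.ofReal_mul (by positivity), gammaRatio, mul_left_comm, Real.rpow_neg hF.le,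
    mul_inv_cancel₀ (by positivity), mul_one]

/-! ### The normalised statistic -/

lemma measurable_statistic (Δ : ℝ) : Measurable (statistic Δ) :=
  (measurable_stableGen Δ).pow_const _

lemma lintegral_statistic_pow (h0 : 0 < Δ) (h1 : Δ < 1) (n : ℕ) :
    ∫⁻ p, ENNReal.ofReal (statistic Δ p ^ n) ∂sourceLaw = ENNReal.ofReal (gammaRatio Δ n) := by
  have hm := measurable_stableGen Δ
  have : IsProbabilityMeasure (sourceLaw.map fun p => stableGen Δ p.1 p.2) :=
    Measure.isProbabilityMeasure_map hm.aemeasurable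
  rw [← lintegral_pow_of_laplace h0 h1 (κ := sourceLaw.map fun p => stableGen Δ p.1 p.2) one_pos,
    lintegral_map (by fun_prop) hm]
  · simp [statistic]
  · rw [ae_map_iff hm.aemeasurable measurableSet_Ioi]
    filter_upwards [ae_sourceLaw] with p ⟨hv, hw⟩ using stableGen_pos h0 h1 hv hw
  · intro l hl
    rw [lintegral_map (by fun_prop) hm, lintegral_exp_neg_stableGen h0 h1 hl.le]
    simp

lemma statistic_nonneg (h0 : 0 < Δ) (h1 : Δ < 1) : ∀ᵐ p ∂sourceLaw, 0 ≤ statistic Δ p := by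
  filter_upwards [ae_sourceLaw] with p ⟨hv, hw⟩
  exact Real.rpow_nonneg (stableGen_pos h0 h1 hv hw).le _

/-- The statistic is an exponential variable times this function of the uniform variable. -/
def weight (Δ v : ℝ) : ℝ := kanter Δ v ^ (1 / Δ)

lemma measurable_weight (Δ : ℝ) : Measurable (weight Δ) := (measurable_kanter Δ).pow_const _

lemma statistic_eq (h0 : 0 < Δ) (h1 : Δ < 1) {p : ℝ × ℝ} (hv : p.1 ∈ Set.Ioo 0 Real.pi)
    (hw : 0 < p.2) : statistic Δ p = p.2 * weight Δ p.1 := by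
  have hα : 0 < 1 - Δ := by linarith
  have hk := kanter_pos h0 h1 hv
  rw [statistic, stableGen_eq h0 h1 hv hw, ← Real.rpow_mul (by positivity),
    show -(1 - Δ)⁻¹ * (-(1 - Δ) / Δ) = 1 / Δ by field_simp, Real.mul_rpow (by positivity) hk.le,
    ← Real.rpow_mul hw.le, mul_one_div_cancel h0.ne', Real.rpow_one, weight]

lemma radius_pos (h0 : 0 < Δ) (h1 : Δ < 1) : 0 < radius Δ :=
  mul_pos h0 (Real.rpow_pos_of_pos (by linarith) _)

lemma weight_pos (h0 : 0 < Δ) (h1 : Δ < 1) {v : ℝ} (hv : v ∈ Set.Ioo 0 Real.pi) :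
    0 < weight Δ v := Real.rpow_pos_of_pos (kanter_pos h0 h1 hv) _

lemma weight_le (h0 : 0 < Δ) (h1 : Δ < 1) {v : ℝ} (hv : v ∈ Set.Ioo 0 Real.pi) :
    weight Δ v ≤ (radius Δ)⁻¹ := by
  have hα : 0 < 1 - Δ := by linarith
  have h := Real.rpow_le_rpow (kanter_pos h0 h1 hv).le (kanter_le h0 h1 hv)
    (show 0 ≤ 1 / Δ by positivity)
  rwa [Real.inv_rpow (by positivity), Real.mul_rpow (by positivity) (by positivity),
    ← Real.rpow_mul hα.le, ← Real.rpow_mul h0.le, mul_one_div_cancel h0.ne', Real.rpow_one,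
    mul_one_div, mul_comm] at h

lemma one_sub_mul_weight_pos (h0 : 0 < Δ) (h1 : Δ < 1) {s : ℝ} (hs : s < radius Δ) {v : ℝ}
    (hv : v ∈ Set.Ioo 0 Real.pi) : 0 < 1 - s * weight Δ v := by
  have hw := weight_pos h0 h1 hv
  have hr := radius_pos h0 h1
  have h : radius Δ * weight Δ v ≤ 1 := by
    have := weight_le h0 h1 hv
    rwa [← one_div, le_div_iff₀ hr, mul_comm] at this
  nlinarith

/-- Given `v`, the statistic is exponential with mean `weight Δ v`, and the inner integral is its
moment generating function. -/
lemma lintegral_exp_statistic (h0 : 0 < Δ) (h1 : Δ < 1) {s : ℝ} (hs : s < radius Δ) :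
    ∫⁻ p, ENNReal.ofReal (Real.exp (s * statistic Δ p)) ∂sourceLaw =
      ∫⁻ v, ENNReal.ofReal (1 / (1 - s * weight Δ v)) ∂uniformLaw := by
  have hm := measurable_statistic Δ
  rw [lintegral_prod _ (by fun_prop)]
  refine lintegral_congr_ae ?_
  filter_upwards [ae_uniformLaw_mem] with v hv
  have hb := one_sub_mul_weight_pos h0 h1 hs hv
  rw [← lintegral_exp_expMeasure (by linarith)]
  refine lintegral_congr_ae ?_
  filter_upwards [ae_expMeasure_pos] with w hw
  rw [statistic_eq h0 h1 hv hw]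
  ring_nf

lemma lintegral_statistic_mul_exp (h0 : 0 < Δ) (h1 : Δ < 1) {s : ℝ} (hs : s < radius Δ) :
    ∫⁻ p, ENNReal.ofReal (statistic Δ p * Real.exp (s * statistic Δ p)) ∂sourceLaw =
      ∫⁻ v, ENNReal.ofReal (weight Δ v / (1 - s * weight Δ v) ^ 2) ∂uniformLaw := by
  have hm := measurable_statistic Δ
  rw [lintegral_prod _ (by fun_prop)]
  refine lintegral_congr_ae ?_
  filter_upwards [ae_uniformLaw_mem] with v hv
  have hb := one_sub_mul_weight_pos h0 h1 hs hv
  have hw0 := weight_pos h0 h1 hv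
  have h := lintegral_rpow_mul_exp_expMeasure (p := 1) (s := s * weight Δ v) (by norm_num)
    (by linarith)
  have e : weight Δ v / (1 - s * weight Δ v) ^ 2 =
      weight Δ v * ((1 / (1 - s * weight Δ v)) ^ ((1 : ℝ) + 1) * Real.Gamma (1 + 1)) := by
    rw [one_add_one_eq_two, Real.Gamma_two, Real.rpow_two]
    field_simp
  rw [e, ENNReal.ofReal_mul hw0.le, ← h, ← lintegral_const_mul _ (by fun_prop)]
  refine lintegral_congr_ae ?_
  filter_upwards [ae_expMeasure_pos] with w hw
  rw [statistic_eq h0 h1 hv hw, ← ENNReal.ofReal_mul hw0.le, Real.rpow_one]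
  ring_nf

lemma one_sub_div_radius_le (h0 : 0 < Δ) (h1 : Δ < 1) {s : ℝ} {v : ℝ}
    (hv : v ∈ Set.Ioo 0 Real.pi) : 1 - |s| / radius Δ ≤ 1 - s * weight Δ v := by
  have hw := weight_pos h0 h1 hv
  have h := weight_le h0 h1 hv
  have : s * weight Δ v ≤ |s| * (radius Δ)⁻¹ :=
    (mul_le_mul_of_nonneg_right (le_abs_self s) hw.le).trans
      (mul_le_mul_of_nonneg_left h (abs_nonneg s))
  rw [div_eq_mul_inv]
  linarith

lemma exists_le_one_sub (h0 : 0 < Δ) (h1 : Δ < 1) {s : ℝ} (hs : s < radius Δ) :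
    ∃ c : ℝ, 0 < c ∧ ∀ v ∈ Set.Ioo 0 Real.pi, c ≤ 1 - s * weight Δ v := by
  rcases le_or_gt s 0 with h | h
  · refine ⟨1, one_pos, fun v hv => ?_⟩
    have := mul_nonneg_of_nonpos_of_nonpos h (neg_nonpos.2 (weight_pos h0 h1 hv).le)
    linarith
  · refine ⟨1 - |s| / radius Δ, ?_, fun v hv => one_sub_div_radius_le h0 h1 hv⟩
    rw [abs_of_pos h, sub_pos, div_lt_one (radius_pos h0 h1)]
    exact hs

lemma integrable_of_bounded_Ioo {f : ℝ → ℝ} (hf : Measurable f) {c : ℝ}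
    (h : ∀ v ∈ Set.Ioo 0 Real.pi, |f v| ≤ c) : Integrable f uniformLaw := by
  refine Integrable.of_bound hf.aestronglyMeasurable c ?_
  filter_upwards [ae_uniformLaw_mem] with v hv using h v hv

lemma integrable_inv_one_sub (h0 : 0 < Δ) (h1 : Δ < 1) {s : ℝ} (hs : s < radius Δ) :
    Integrable (fun v => 1 / (1 - s * weight Δ v)) uniformLaw := by
  obtain ⟨c, hc, hb⟩ := exists_le_one_sub h0 h1 hs
  have hm := measurable_weight Δ
  refine integrable_of_bounded_Ioo (by fun_prop) (c := 1 / c) fun v hv => ?_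
  have := hb v hv
  rw [abs_of_pos (by have := hc.trans_le this; positivity)]
  gcongr

lemma integrable_weight_div (h0 : 0 < Δ) (h1 : Δ < 1) {s : ℝ} (hs : s < radius Δ) :
    Integrable (fun v => weight Δ v / (1 - s * weight Δ v) ^ 2) uniformLaw := by
  obtain ⟨c, hc, hb⟩ := exists_le_one_sub h0 h1 hs
  have hm := measurable_weight Δ
  refine integrable_of_bounded_Ioo (by fun_prop) (c := (radius Δ)⁻¹ / c ^ 2) fun v hv => ?_
  have := hb v hv
  have hw := weight_pos h0 h1 hv
  have hr := radius_pos h0 h1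
  rw [abs_of_pos (by have := hc.trans_le this; positivity)]
  gcongr
  exact weight_le h0 h1 hv

lemma ae_uniformLaw_of {p : ℝ → Prop} (h : ∀ v ∈ Set.Ioo 0 Real.pi, p v) :
    ∀ᵐ v ∂uniformLaw, p v := by
  filter_upwards [ae_uniformLaw_mem] with v hv using h v hv

lemma integrable_exp_statistic (h0 : 0 < Δ) (h1 : Δ < 1) {s : ℝ} (hs : s < radius Δ) :
    Integrable (fun p => Real.exp (s * statistic Δ p)) sourceLaw := by
  have hm := measurable_statistic Δ
  refine ⟨by fun_prop, ?_⟩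
  rw [hasFiniteIntegral_iff_ofReal (.of_forall fun x => (Real.exp_pos _).le),
    lintegral_exp_statistic h0 h1 hs, ← hasFiniteIntegral_iff_ofReal]
  · exact (integrable_inv_one_sub h0 h1 hs).2
  · exact ae_uniformLaw_of fun v hv => one_div_nonneg.2 (one_sub_mul_weight_pos h0 h1 hs hv).le

lemma integrable_statistic_mul_exp (h0 : 0 < Δ) (h1 : Δ < 1) {s : ℝ} (hs : s < radius Δ) :
    Integrable (fun p => statistic Δ p * Real.exp (s * statistic Δ p)) sourceLaw := by
  have hm := measurable_statistic Δ
  refine ⟨by fun_prop, ?_⟩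
  rw [hasFiniteIntegral_iff_ofReal, lintegral_statistic_mul_exp h0 h1 hs,
    ← hasFiniteIntegral_iff_ofReal]
  · exact (integrable_weight_div h0 h1 hs).2
  · exact ae_uniformLaw_of fun v hv => div_nonneg (weight_pos h0 h1 hv).le (sq_nonneg _)
  · filter_upwards [statistic_nonneg h0 h1] with p hp using mul_nonneg hp (Real.exp_pos _).le

lemma M_eq (h0 : 0 < Δ) (h1 : Δ < 1) {s : ℝ} (hs : s < radius Δ) :
    M Δ s = ∫ v, 1 / (1 - s * weight Δ v) ∂uniformLaw := by
  have hm := measurable_statistic Δ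
  rw [M, integral_eq_lintegral_of_nonneg_ae (.of_forall fun p => (Real.exp_pos _).le)
    (by fun_prop), lintegral_exp_statistic h0 h1 hs, integral_eq_lintegral_of_nonneg_ae _
    (integrable_inv_one_sub h0 h1 hs).1]
  exact ae_uniformLaw_of fun v hv => one_div_nonneg.2 (one_sub_mul_weight_pos h0 h1 hs hv).le

lemma M'_eq (h0 : 0 < Δ) (h1 : Δ < 1) {s : ℝ} (hs : s < radius Δ) :
    M' Δ s = ∫ v, weight Δ v / (1 - s * weight Δ v) ^ 2 ∂uniformLaw := by
  rw [M', integral_eq_lintegral_of_nonneg_ae _ (integrable_statistic_mul_exp h0 h1 hs).1,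
    lintegral_statistic_mul_exp h0 h1 hs, integral_eq_lintegral_of_nonneg_ae _
    (integrable_weight_div h0 h1 hs).1]
  · exact ae_uniformLaw_of fun v hv => div_nonneg (weight_pos h0 h1 hv).le (sq_nonneg _)
  · filter_upwards [statistic_nonneg h0 h1] with p hp using mul_nonneg hp (Real.exp_pos _).le

lemma integral_statistic_pow (h0 : 0 < Δ) (h1 : Δ < 1) (n : ℕ) :
    ∫ p, statistic Δ p ^ n ∂sourceLaw = gammaRatio Δ n := by
  have hm := measurable_statistic Δ
  rw [integral_eq_lintegral_of_nonneg_ae _ (by fun_prop), lintegral_statistic_pow h0 h1,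
    ENNReal.toReal_ofReal (gammaRatio_nonneg h0 h1 n)]
  filter_upwards [statistic_nonneg h0 h1] with p hp using pow_nonneg hp n

theorem hasSum_M (h0 : 0 < Δ) (h1 : Δ < 1) {s : ℝ} (hs : |s| < radius Δ) :
    HasSum (fun n : ℕ => s ^ n / (n.factorial : ℝ) * gammaRatio Δ n) (M Δ s) := by
  have h := hasSum_integral_mul_exp (P := sourceLaw) (g := fun _ => 1) (t := s) (by fun_prop)
    (measurable_statistic Δ).aestronglyMeasurable (.of_forall fun _ => zero_le_one)
    (statistic_nonneg h0 h1) (by simpa using integrable_exp_statistic h0 h1 hs)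
  simp only [one_mul, integral_statistic_pow h0 h1] at h
  exact h

theorem hasSum_M' (h0 : 0 < Δ) (h1 : Δ < 1) {s : ℝ} (hs : |s| < radius Δ) :
    HasSum (fun n : ℕ => s ^ n / (n.factorial : ℝ) * gammaRatio Δ (n + 1)) (M' Δ s) := by
  have hm := (measurable_statistic Δ).aestronglyMeasurable (μ := sourceLaw)
  have h := hasSum_integral_mul_exp (P := sourceLaw) (g := statistic Δ) (t := s) hm hm
    (statistic_nonneg h0 h1) (statistic_nonneg h0 h1) (integrable_statistic_mul_exp h0 h1 hs)
  simp only [← pow_succ', integral_statistic_pow h0 h1] at h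
  exact h

/-- A positive law with Laplace transform `exp (-F l ^ α)` gives, after normalisation, the law of
the statistic. -/
theorem map_rpow_of_laplace (h0 : 0 < Δ) (h1 : Δ < 1) {κ : Measure ℝ} [IsProbabilityMeasure κ]
    {F : ℝ} (hF : 0 < F) (hκ : ∀ᵐ x ∂κ, 0 < x)
    (hL : ∀ l : ℝ, 0 < l → ∫⁻ x, ENNReal.ofReal (Real.exp (-(l * x))) ∂κ =
      ENNReal.ofReal (Real.exp (-F * l ^ (1 - Δ)))) :
    κ.map (fun x => F ^ (1 / Δ) * x ^ (-(1 - Δ) / Δ)) = sourceLaw.map (statistic Δ) := by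
  have hm := measurable_statistic Δ
  have hm' : Measurable fun x : ℝ => F ^ (1 / Δ) * x ^ (-(1 - Δ) / Δ) := by fun_prop
  have := Measure.isProbabilityMeasure_map (μ := κ) hm'.aemeasurable
  have := Measure.isProbabilityMeasure_map (μ := sourceLaw) hm.aemeasurable
  have hr := radius_pos h0 h1
  refine measure_ext_of_moments ?_ ?_ (fun n => ?_) (s := radius Δ / 2) (by positivity) ?_
  · rw [ae_map_iff hm'.aemeasurable measurableSet_Ici]
    filter_upwards [hκ] with x hx
    positivity
  · rw [ae_map_iff hm.aemeasurable measurableSet_Ici]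
    exact statistic_nonneg h0 h1
  · rw [lintegral_map (by fun_prop) hm, lintegral_map (by fun_prop) hm',
      lintegral_statistic_pow h0 h1, lintegral_pow_of_laplace h0 h1 hF hκ hL]
  · rw [integrable_map_measure (by fun_prop) hm.aemeasurable]
    exact integrable_exp_statistic h0 h1 (by linarith)

end

section

/-! ### The moment generating function -/

variable {Δ : ℝ}

lemma radius_le (h0 : 0 < Δ) (h1 : Δ < 1) : radius Δ ≤ Δ := by
  have hα : 0 < 1 - Δ := by linarith
  exact mul_le_of_le_one_right h0.le (Real.rpow_le_one hα.le (by linarith) (by positivity))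

/-- From `log α ≥ 1 - 1/α` one gets `(α/Δ) log α ≥ -1`. The radius is thus comparable to `Δ`, which
makes all later constants uniform in `Δ`. -/
lemma mul_exp_neg_one_le_radius (h0 : 0 < Δ) (h1 : Δ < 1) : Δ * Real.exp (-1) ≤ radius Δ := by
  have hα : 0 < 1 - Δ := by linarith
  refine mul_le_mul_of_nonneg_left ?_ h0.le
  rw [Real.rpow_def_of_pos hα]
  refine Real.exp_le_exp.2 ?_
  have h := Real.one_sub_inv_le_log_of_pos hα
  have e : (1 - (1 - Δ)⁻¹) * ((1 - Δ) / Δ) = -1 := by field_simp; ring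
  rw [← e]
  exact mul_le_mul_of_nonneg_right h (by positivity)

lemma mul_lt_radius (h0 : 0 < Δ) (h1 : Δ < 1) {τ : ℝ} (hτ : |τ| ≤ 1 / 6) :
    Δ * τ < radius Δ := by
  refine lt_of_lt_of_le (mul_lt_mul_of_pos_left ?_ h0) (mul_exp_neg_one_le_radius h0 h1)
  have : (3 : ℝ)⁻¹ < (Real.exp 1)⁻¹ := by
    gcongr
    exact Real.exp_one_lt_three
  rw [Real.exp_neg]
  linarith [(abs_le.1 hτ).2]

lemma mul_weight_le (h0 : 0 < Δ) (h1 : Δ < 1) {v : ℝ} (hv : v ∈ Set.Ioo 0 Real.pi) :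
    Δ * weight Δ v ≤ 3 := by
  have h := weight_le h0 h1 hv
  have hr := mul_exp_neg_one_le_radius h0 h1
  have hr' := radius_pos h0 h1
  have : Δ * (radius Δ)⁻¹ ≤ Real.exp 1 := by
    rw [← div_eq_mul_inv, div_le_iff₀ hr']
    calc Δ = Real.exp 1 * (Δ * Real.exp (-1)) := by
          rw [mul_left_comm, ← Real.exp_add]; simp
      _ ≤ _ := by gcongr
  have := Real.exp_one_lt_three
  nlinarith

lemma gammaRatio_one (h0 : 0 < Δ) : gammaRatio Δ 1 = 1 / Δ := by
  have e : 1 + ((1 : ℕ) : ℝ) * (1 - Δ) / Δ = 1 / Δ := by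
    push_cast; field_simp; ring
  have hg := Real.Gamma_pos_of_pos (show 0 < 1 / Δ by positivity)
  rw [gammaRatio, e, add_comm, Nat.cast_one, Real.Gamma_add_one (by positivity)]
  field_simp

lemma M_zero : M Δ 0 = 1 := by simp [M]

lemma M'_zero (h0 : 0 < Δ) (h1 : Δ < 1) : M' Δ 0 = 1 / Δ := by
  have := integral_statistic_pow h0 h1 1
  rw [gammaRatio_one h0] at this
  simpa [M'] using this

lemma integrable_weight (h0 : 0 < Δ) (h1 : Δ < 1) : Integrable (weight Δ) uniformLaw := by
  simpa using integrable_weight_div h0 h1 (radius_pos h0 h1)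

lemma integral_weight (h0 : 0 < Δ) (h1 : Δ < 1) : ∫ v, weight Δ v ∂uniformLaw = 1 / Δ := by
  rw [← M'_zero h0 h1, M'_eq h0 h1 (radius_pos h0 h1)]
  simp

lemma integral_mul_weight_sub_one (h0 : 0 < Δ) (h1 : Δ < 1) :
    ∫ v, (Δ * weight Δ v - 1) ∂uniformLaw = 0 := by
  rw [integral_sub ((integrable_weight h0 h1).const_mul Δ) (integrable_const _),
    integral_const_mul, integral_weight h0 h1]
  simp [h0.ne']

lemma integrable_mul_weight_sub_one (h0 : 0 < Δ) (h1 : Δ < 1) :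
    Integrable (fun v => Δ * weight Δ v - 1) uniformLaw :=
  ((integrable_weight h0 h1).const_mul Δ).sub (integrable_const (1 : ℝ))

lemma integral_affine_weight (h0 : 0 < Δ) (h1 : Δ < 1) (a b : ℝ) :
    ∫ v, (a + b * (Δ * weight Δ v - 1)) ∂uniformLaw = a := by
  rw [integral_add (integrable_const _) ((integrable_mul_weight_sub_one h0 h1).const_mul b),
    integral_const_mul, integral_mul_weight_sub_one h0 h1]
  simp

/-- Jensen's inequality for the moment generating function. -/
lemma le_M (h0 : 0 < Δ) (h1 : Δ < 1) {s : ℝ} (hs : s < radius Δ) :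
    1 / (1 - s / Δ) ≤ M Δ s := by
  have hτ : 0 < 1 - s / Δ := by
    rw [sub_pos, div_lt_one h0]
    exact hs.trans_le (radius_le h0 h1)
  have hi := integrable_mul_weight_sub_one h0 h1
  -- The left integrand is the tangent at `z = 1` of `z ↦ 1 / (1 - τz)`, where `τ = s/Δ` and `z = Δ
  -- * weight Δ v` has mean `1`.
  have key : ∫ v, (1 / (1 - s / Δ) + s / Δ / (1 - s / Δ) ^ 2 * (Δ * weight Δ v - 1)) ∂uniformLaw ≤
      ∫ v, 1 / (1 - s * weight Δ v) ∂uniformLaw := by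
    refine integral_mono_ae ((integrable_const _).add (hi.const_mul _))
      (integrable_inv_one_sub h0 h1 hs) (ae_uniformLaw_of fun v hv => ?_)
    have hb := one_sub_mul_weight_pos h0 h1 hs hv
    have e : s * weight Δ v = s / Δ * (Δ * weight Δ v) := by field_simp
    rw [e] at hb
    simp only [e]
    generalize s / Δ = τ at *
    generalize Δ * weight Δ v = z at *
    have : 1 / (1 - τ * z) - (1 / (1 - τ) + τ / (1 - τ) ^ 2 * (z - 1)) =
        τ ^ 2 * (z - 1) ^ 2 / ((1 - τ * z) * (1 - τ) ^ 2) := by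
      field_simp
      ring
    have h2 : 0 ≤ τ ^ 2 * (z - 1) ^ 2 / ((1 - τ * z) * (1 - τ) ^ 2) := by positivity
    linarith
  rwa [integral_affine_weight h0 h1, ← M_eq h0 h1 hs] at key

lemma M_pos (h0 : 0 < Δ) (h1 : Δ < 1) {s : ℝ} (hs : s < radius Δ) : 0 < M Δ s := by
  refine lt_of_lt_of_le (one_div_pos.2 ?_) (le_M h0 h1 hs)
  rw [sub_pos, div_lt_one h0]
  exact hs.trans_le (radius_le h0 h1)

/-- With `z = weight Δ v`, the difference of the integrands is `(Δz - 1) / (1 + tz) ^ 2`. Replacing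
the denominator by its value at `z = 1/Δ` can only increase this, whatever the sign of `Δz - 1`, and
the result has mean zero. -/
lemma M'_neg_le (h0 : 0 < Δ) (h1 : Δ < 1) {t : ℝ} (ht : 0 ≤ t) :
    M' Δ (-t) * (Δ + t) ≤ M Δ (-t) := by
  have hr := radius_pos h0 h1
  have hs : -t < radius Δ := by linarith
  have hi := (integrable_weight_div h0 h1 hs).mul_const (Δ + t)
  have hj := integrable_inv_one_sub h0 h1 hs
  have hk := (integrable_mul_weight_sub_one h0 h1).const_mul
    (1 / (1 + t / Δ) ^ 2)
  rw [M_eq h0 h1 hs, M'_eq h0 h1 hs, ← integral_mul_const, ← sub_nonpos, ← integral_sub hi hj,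
    ← mul_zero (1 / (1 + t / Δ) ^ 2), ← integral_mul_weight_sub_one h0 h1, ← integral_const_mul]
  refine integral_mono_ae (hi.sub hj) hk (ae_uniformLaw_of fun v hv => ?_)
  have hw := weight_pos h0 h1 hv
  have hb := one_sub_mul_weight_pos h0 h1 hs hv
  simp only
  generalize weight Δ v = z at *
  rw [neg_mul, sub_neg_eq_add] at *
  have e1 : z / (1 + t * z) ^ 2 * (Δ + t) - 1 / (1 + t * z) = (Δ * z - 1) / (1 + t * z) ^ 2 := by
    field_simp
    ring
  have ht' : 0 ≤ t / Δ := by positivity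
  rw [e1, one_div_mul_eq_div]
  rcases le_total 1 (Δ * z) with h | h
  · gcongr
    rw [div_le_iff₀ h0]
    nlinarith
  · rw [← neg_le_neg_iff, ← neg_div, ← neg_div]
    gcongr
    · linarith
    · rw [le_div_iff₀ h0]
      nlinarith

/-- Put `z = Δ * weight Δ v`, so `0 < z ≤ 3` and `z` has mean `1`. As `|τ| ≤ 1/6` forces `τz ≤ 1/2`,
the integrand is at most `1 + τz + 2(τz)²`, and `2(τz)² ≤ 6τ²z`. -/
lemma M_le (h0 : 0 < Δ) (h1 : Δ < 1) {τ : ℝ} (hτ : |τ| ≤ 1 / 6) :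
    M Δ (Δ * τ) ≤ 1 + τ + 6 * τ ^ 2 := by
  have hs := mul_lt_radius h0 h1 hτ
  have hi := integrable_mul_weight_sub_one h0 h1
  have key : ∫ v, 1 / (1 - Δ * τ * weight Δ v) ∂uniformLaw ≤
      ∫ v, (1 + τ + 6 * τ ^ 2 + (τ + 6 * τ ^ 2) * (Δ * weight Δ v - 1)) ∂uniformLaw := by
    refine integral_mono_ae (integrable_inv_one_sub h0 h1 hs)
      ((integrable_const _).add (hi.const_mul _)) (ae_uniformLaw_of fun v hv => ?_)
    have hz := mul_weight_le h0 h1 hv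
    have hz0 : 0 < Δ * weight Δ v := mul_pos h0 (weight_pos h0 h1 hv)
    have e : Δ * τ * weight Δ v = τ * (Δ * weight Δ v) := by ring
    simp only [e]
    generalize Δ * weight Δ v = z at *
    have hu : τ * z ≤ 1 / 2 := by
      have := (abs_le.1 hτ).2
      nlinarith
    have hq : 1 / (1 - τ * z) ≤ 1 + τ * z + 2 * (τ * z) ^ 2 := by
      rw [div_le_iff₀ (by linarith)]
      nlinarith [sq_nonneg (τ * z)]
    have : 2 * (τ * z) ^ 2 ≤ 6 * τ ^ 2 * z := by nlinarith [mul_nonneg (sq_nonneg τ) hz0.le]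
    linarith
  rwa [integral_affine_weight h0 h1, ← M_eq h0 h1 hs] at key

/-- The variance of `X = 1 / (1 - s weight)` is nonnegative, and `s weight / (1 - s weight)² = X² -
X`. Hence `M' / M` is large wherever `M` is. -/
lemma M_sq_le (h0 : 0 < Δ) (h1 : Δ < 1) {s : ℝ} (hs : s < radius Δ) :
    M Δ s ^ 2 - M Δ s ≤ s * M' Δ s := by
  have hi := (integrable_weight_div h0 h1 hs).const_mul s
  have hj := integrable_inv_one_sub h0 h1 hs
  have key : ∫ v, ((2 * M Δ s - 1) * (1 / (1 - s * weight Δ v)) - M Δ s ^ 2) ∂uniformLaw ≤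
      ∫ v, s * (weight Δ v / (1 - s * weight Δ v) ^ 2) ∂uniformLaw := by
    refine integral_mono_ae ((hj.const_mul _).sub (integrable_const _)) hi
      (ae_uniformLaw_of fun v hv => ?_)
    have hb := one_sub_mul_weight_pos h0 h1 hs hv
    have e : s * (weight Δ v / (1 - s * weight Δ v) ^ 2) =
        (1 / (1 - s * weight Δ v)) ^ 2 - 1 / (1 - s * weight Δ v) := by
      field_simp
      ring
    simp only [e]
    nlinarith [sq_nonneg (1 / (1 - s * weight Δ v) - M Δ s)]
  rw [integral_sub (hj.const_mul _) (integrable_const _), integral_const_mul, integral_const_mul,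
    ← M_eq h0 h1 hs, ← M'_eq h0 h1 hs] at key
  simp only [integral_const, probReal_univ, smul_eq_mul, one_mul] at key
  linarith

/-- Near `v = 0` the weight attains its supremum up to a term of order `v²`, which makes `M` blow up
at the radius. The proof combines `sin v ≥ v - v³/4`, `sin (c v) ≤ c v` and Bernoulli's inequality.
-/
lemma le_radius_mul_weight (h0 : 0 < Δ) (h1 : Δ < 1) {v : ℝ} (hv : 0 < v) (hv1 : v ≤ 1) :
    1 - 1 / (4 * Δ) * v ^ 2 ≤ radius Δ * weight Δ v := by
  have hα : 0 < 1 - Δ := by linarith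
  have hπ : v ∈ Set.Ioo 0 Real.pi := ⟨hv, by linarith [Real.pi_gt_three]⟩
  have a := sin_left_pos h0 h1 hπ
  have b := sin_right_pos h0 h1 hπ
  have c := Real.sin_pos_of_mem_Ioo hπ
  have h2 : 1 + -(v ^ 2 / 4) ≤ Real.sin v / v := by
    rw [le_div_iff₀ hv]
    have := Real.sin_gt_sub_cube hv
    nlinarith [pow_pos hv 3]
  have hk : Real.sin v / v ≤ kanter Δ v * ((1 - Δ) ^ (1 - Δ) * Δ ^ Δ) := by
    have hle : Real.sin ((1 - Δ) * v) ^ (1 - Δ) * Real.sin (v * Δ) ^ Δ ≤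
        ((1 - Δ) ^ (1 - Δ) * Δ ^ Δ) * v := by
      calc _ ≤ ((1 - Δ) * v) ^ (1 - Δ) * (v * Δ) ^ Δ := by
            gcongr
            · exact Real.sin_le (by positivity)
            · exact Real.sin_le (by positivity)
        _ = _ := by
          rw [Real.mul_rpow hα.le hv.le, Real.mul_rpow hv.le h0.le]
          have : v ^ (1 - Δ) * v ^ Δ = v := by rw [← Real.rpow_add hv]; simp
          linear_combination ((1 - Δ) ^ (1 - Δ) * Δ ^ Δ) * this
    rw [kanter, div_mul_eq_mul_div, div_le_div_iff₀ hv (by positivity), mul_assoc]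
    gcongr
  have e : radius Δ * weight Δ v = (kanter Δ v * ((1 - Δ) ^ (1 - Δ) * Δ ^ Δ)) ^ (1 / Δ) := by
    have := kanter_pos h0 h1 hπ
    rw [Real.mul_rpow (by positivity) (by positivity), Real.mul_rpow (by positivity)
      (by positivity), ← Real.rpow_mul hα.le, ← Real.rpow_mul h0.le, mul_one_div_cancel h0.ne',
      Real.rpow_one, radius, weight, mul_one_div]
    ring
  have hv2 : v ^ 2 ≤ 1 := by nlinarith
  rw [e]
  calc 1 - 1 / (4 * Δ) * v ^ 2 = 1 + 1 / Δ * -(v ^ 2 / 4) := by field_simp; ring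
    _ ≤ (1 + -(v ^ 2 / 4)) ^ (1 / Δ) := by
      refine one_add_mul_self_le_rpow_one_add (by linarith) ?_
      rw [le_div_iff₀ h0]
      linarith
    _ ≤ _ := Real.rpow_le_rpow (by linarith) (h2.trans hk) (by positivity)

/-- At `s = radius Δ * (1 - x²)` the integrand is at least `1 / (x² (1 + c))` on `(0, x)`, a set of
probability `x/π`. By Markov's inequality `M ≥ 1 / (π (1 + c) x)`, which exceeds `K` for small `x`.
-/
lemma exists_lt_M (h0 : 0 < Δ) (h1 : Δ < 1) (K : ℝ) : ∃ s, 0 < s ∧ s < radius Δ ∧ K < M Δ s := by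
  have hr := radius_pos h0 h1
  set c : ℝ := 1 / (4 * Δ) with hc
  have hc0 : 0 < c := by positivity
  obtain ⟨x, hx0, hx1, hx⟩ : ∃ x : ℝ, 0 < x ∧ x < 1 ∧ x * (Real.pi * (1 + c) * (|K| + 1)) < 1 := by
    have hp : 0 < Real.pi * (1 + c) * (|K| + 1) := by positivity
    refine ⟨min (1 / 2) (1 / (2 * (Real.pi * (1 + c) * (|K| + 1)))), by positivity,
      (min_le_left _ _).trans_lt (by norm_num), ?_⟩
    calc _ ≤ 1 / (2 * (Real.pi * (1 + c) * (|K| + 1))) * (Real.pi * (1 + c) * (|K| + 1)) := by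
          gcongr
          exact min_le_right _ _
      _ = 1 / 2 := by field_simp
      _ < 1 := by norm_num
  have hx2 : x ^ 2 < 1 := by nlinarith
  have hs : radius Δ * (1 - x ^ 2) < radius Δ := by nlinarith [pow_pos hx0 2]
  refine ⟨radius Δ * (1 - x ^ 2), mul_pos hr (by linarith), hs, ?_⟩
  have hmarkov := mul_meas_ge_le_integral_of_nonneg (μ := uniformLaw)
    (f := fun v => 1 / (1 - radius Δ * (1 - x ^ 2) * weight Δ v))
    (ae_uniformLaw_of fun v hv => one_div_nonneg.2 (one_sub_mul_weight_pos h0 h1 hs hv).le)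
    (integrable_inv_one_sub h0 h1 hs) (1 / (x ^ 2 * (1 + c)))
  rw [← M_eq h0 h1 hs] at hmarkov
  have hsub : Set.Ioo 0 x ⊆ {v | 1 / (x ^ 2 * (1 + c)) ≤
      1 / (1 - radius Δ * (1 - x ^ 2) * weight Δ v)} := by
    intro v ⟨hv0, hvx⟩
    have hl := le_radius_mul_weight h0 h1 hv0 (by linarith)
    have hb := one_sub_mul_weight_pos h0 h1 hs (v := v) ⟨hv0, by linarith [Real.pi_gt_three]⟩
    refine one_div_le_one_div_of_le hb ?_
    have hvx2 : v ^ 2 ≤ x ^ 2 := by gcongr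
    rw [← hc] at hl
    have : (1 - x ^ 2) * (1 - c * v ^ 2) ≤ (1 - x ^ 2) * (radius Δ * weight Δ v) :=
      mul_le_mul_of_nonneg_left hl (by linarith)
    nlinarith [mul_nonneg (sq_nonneg x) (mul_nonneg hc0.le (sq_nonneg v))]
  have hU : uniformLaw.real (Set.Ioo 0 x) = x / Real.pi := by
    rw [uniformLaw, measureReal_def, cond_apply measurableSet_Ioo,
      Set.inter_eq_right.2 (Set.Ioo_subset_Ioo_right (by linarith [Real.pi_gt_three])),
      Real.volume_Ioo, Real.volume_Ioo, ENNReal.toReal_mul, ENNReal.toReal_inv,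
      sub_zero, sub_zero,
      ENNReal.toReal_ofReal Real.pi_pos.le, ENNReal.toReal_ofReal hx0.le]
    simp [div_eq_inv_mul]
  have hmono := measureReal_mono (μ := uniformLaw) hsub
  rw [hU] at hmono
  have h3 : 1 / (x ^ 2 * (1 + c)) * (x / Real.pi) ≤ M Δ (radius Δ * (1 - x ^ 2)) :=
    (mul_le_mul_of_nonneg_left hmono (by positivity)).trans hmarkov
  refine lt_of_lt_of_le ?_ h3
  have e : 1 / (x ^ 2 * (1 + c)) * (x / Real.pi) = 1 / (x * (Real.pi * (1 + c))) := by
    field_simp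
  rw [e, lt_div_iff₀ (by positivity)]
  have := le_abs_self K
  have hpos : 0 < x * (Real.pi * (1 + c)) := by positivity
  nlinarith

/-! ### Continuity of `M` and `M'`, and the saddle point equation. -/

lemma Iio_radius_subset (h0 : 0 < Δ) (h1 : Δ < 1) :
    Set.Iio (radius Δ) ⊆ interior (integrableExpSet (statistic Δ) sourceLaw) :=
  interior_maximal (fun _ ht => integrable_exp_statistic h0 h1 ht) isOpen_Iio

lemma continuousOn_M (h0 : 0 < Δ) (h1 : Δ < 1) : ContinuousOn (M Δ) (Set.Iio (radius Δ)) :=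
  continuousOn_mgf.mono (Iio_radius_subset h0 h1)

lemma continuousOn_M' (h0 : 0 < Δ) (h1 : Δ < 1) :
    ContinuousOn (M' Δ) (Set.Iio (radius Δ)) := by
  intro t ht
  have := (hasDerivAt_integral_pow_mul_exp_real (Iio_radius_subset h0 h1 ht) 1).continuousAt
  simp only [pow_one] at this
  exact this.continuousWithinAt

/-- The saddle point equation has at most one solution. -/
lemma saddle_unique (h0 : 0 < Δ) (h1 : Δ < 1) {a b y : ℝ} (hy : y ≠ 1 / Δ)
    (ha : a < radius Δ) (hb : b < radius Δ) (hMa : M' Δ a = y * M Δ a)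
    (hMb : M' Δ b = y * M Δ b) : a = b := by
  wlog hab : a < b generalizing a b
  · rcases eq_or_lt_of_le (not_lt.1 hab) with h | h
    · exact h.symm
    · exact (this hb ha hMb hMa h).symm
  exfalso
  -- Up to a positive factor the equation says `E (Y - y) exp (s (Y - y)) = 0`. The integrand is
  -- strictly increasing in `s` unless `Y = y`, so two solutions would force `Y = y` almost surely,
  -- against `E Y = 1/Δ ≠ y`.
  have hform (s : ℝ) (p : ℝ × ℝ) : (statistic Δ p - y) * Real.exp (s * (statistic Δ p - y)) =
      Real.exp (-(s * y)) * (statistic Δ p * Real.exp (s * statistic Δ p) -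
        y * Real.exp (s * statistic Δ p)) := by
    rw [mul_sub, sub_eq_neg_add (s * _), Real.exp_add]
    ring
  have hint (s : ℝ) (hs : s < radius Δ) : Integrable (fun p => (statistic Δ p - y) *
      Real.exp (s * (statistic Δ p - y))) sourceLaw := by
    simp only [hform]
    exact ((integrable_statistic_mul_exp h0 h1 hs).sub
      ((integrable_exp_statistic h0 h1 hs).const_mul y)).const_mul _
  have hzero (s : ℝ) (hs : s < radius Δ) (h : M' Δ s = y * M Δ s) :
      ∫ p, (statistic Δ p - y) * Real.exp (s * (statistic Δ p - y)) ∂sourceLaw = 0 := by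
    simp only [hform]
    rw [integral_const_mul, integral_sub (integrable_statistic_mul_exp h0 h1 hs)
      ((integrable_exp_statistic h0 h1 hs).const_mul y), integral_const_mul]
    change _ * (M' Δ s - y * M Δ s) = 0
    rw [h, sub_self, mul_zero]
  have hlt (z : ℝ) (hz : z ≠ 0) : z * Real.exp (a * z) < z * Real.exp (b * z) := by
    rcases lt_or_gt_of_ne hz with h | h
    · exact mul_lt_mul_of_neg_left (Real.exp_lt_exp.2 (mul_lt_mul_of_neg_right hab h)) h
    · exact mul_lt_mul_of_pos_left (Real.exp_lt_exp.2 (mul_lt_mul_of_pos_right hab h)) h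
  have heq := (integral_eq_iff_of_ae_le (hint a ha) (hint b hb) (.of_forall fun p => by
    rcases eq_or_ne (statistic Δ p - y) 0 with h | h
    · simp [h]
    · exact (hlt _ h).le)).1 ((hzero a ha hMa).trans (hzero b hb hMb).symm)
  have hY : statistic Δ =ᵐ[sourceLaw] fun _ => y := by
    filter_upwards [heq] with p hp
    by_contra hne
    exact (hlt _ (sub_ne_zero.2 hne)).ne hp
  have h := integral_congr_ae hY
  have h2 := M'_zero h0 h1
  rw [M'] at h2
  simp only [zero_mul, Real.exp_zero, mul_one] at h2
  rw [h2] at h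
  apply hy
  simpa using h.symm

/-- A saddle point maximises the exponent of Chernoff's bound. -/
lemma saddle_optimal (h0 : 0 < Δ) (h1 : Δ < 1) {a s y : ℝ} (ha : a < radius Δ)
    (hs : s < radius Δ) (hMa : M' Δ a = y * M Δ a) :
    -Real.log (M Δ s) + s * y ≤ -Real.log (M Δ a) + a * y := by
  -- Apply `exp x ≥ 1 + x` with `x = (s - a)(Y - y)` under the weight `exp (a Y)`; the saddle
  -- equation kills the linear term.
  have key : M Δ a * Real.exp ((s - a) * y) ≤ M Δ s := by
    have hi := (integrable_exp_statistic h0 h1 ha)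
    have hj := (integrable_statistic_mul_exp h0 h1 ha)
    have hmono : ∫ p, Real.exp ((s - a) * y) * ((1 - (s - a) * y) *
        Real.exp (a * statistic Δ p) + (s - a) * (statistic Δ p * Real.exp (a * statistic Δ p)))
          ∂sourceLaw ≤ M Δ s := by
      refine integral_mono (((hi.const_mul _).add (hj.const_mul _)).const_mul _)
        (integrable_exp_statistic h0 h1 hs) fun p => ?_
      have h := Real.add_one_le_exp ((s - a) * (statistic Δ p - y))
      have e : Real.exp (s * statistic Δ p) = Real.exp ((s - a) * y) * Real.exp (a * statistic Δ p)
          * Real.exp ((s - a) * (statistic Δ p - y)) := by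
        rw [← Real.exp_add, ← Real.exp_add]; ring_nf
      simp only [e]
      refine le_trans (le_of_eq ?_) (mul_le_mul_of_nonneg_left h (by positivity))
      ring
    rw [integral_const_mul, integral_add (hi.const_mul _) (hj.const_mul _), integral_const_mul,
      integral_const_mul] at hmono
    change Real.exp ((s - a) * y) * ((1 - (s - a) * y) * M Δ a + (s - a) * M' Δ a) ≤ _ at hmono
    rw [hMa] at hmono
    linarith
  have h := Real.log_le_log (by have := M_pos h0 h1 ha; positivity) key
  rw [Real.log_mul (M_pos h0 h1 ha).ne' (Real.exp_pos _).ne', Real.log_exp] at h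
  linarith

lemma exists_saddle (h0 : 0 < Δ) (h1 : Δ < 1) {a b y : ℝ} (hab : a ≤ b) (hb : b < radius Δ)
    (hMa : M' Δ a < y * M Δ a) (hMb : y * M Δ b < M' Δ b) :
    ∃ s ∈ Set.Ioo a b, M' Δ s = y * M Δ s := by
  have hsub : Set.Icc a b ⊆ Set.Iio (radius Δ) := fun x hx => lt_of_le_of_lt hx.2 hb
  have hc : ContinuousOn (fun s => M' Δ s - y * M Δ s) (Set.Icc a b) :=
    ((continuousOn_M' h0 h1).sub ((continuousOn_M h0 h1).const_mul y)).mono hsub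
  obtain ⟨s, hs, h⟩ := intermediate_value_Ioo hab hc (show (0 : ℝ) ∈ Set.Ioo _ _ from
    ⟨sub_neg.2 hMa, sub_pos.2 hMb⟩)
  exact ⟨s, hs, sub_eq_zero.1 h⟩

end

section

/-! ### The constants of the tail bounds -/

variable {Δ ν : ℝ}

/-- By optimality the rate at `a` dominates the exponent at `Δτ`, where `log M ≤ M - 1 ≤ τ + 6τ²`.
No knowledge of the position of `a` is needed. -/
lemma le_rate (h0 : 0 < Δ) (h1 : Δ < 1) {a y τ : ℝ} (ha : a < radius Δ)
    (hMa : M' Δ a = y / Δ * M Δ a) (hτ : |τ| ≤ 1 / 6) :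
    τ * (y - 1) - 6 * τ ^ 2 ≤ -Real.log (M Δ a) + a * (y / Δ) := by
  have hs := mul_lt_radius h0 h1 hτ
  have h := saddle_optimal h0 h1 ha hs hMa
  have hl := Real.log_le_sub_one_of_pos (M_pos h0 h1 hs)
  have hM := M_le h0 h1 hτ
  have e : Δ * τ * (y / Δ) = τ * y := by field_simp
  rw [e] at h
  linarith

lemma isRightPoint_iff (h0 : 0 < Δ) (h1 : Δ < 1) {ε t : ℝ} : IsRightPoint Δ ε t ↔
    0 < t ∧ M' Δ (-t) = 1 / (1 + ε) ^ (1 / Δ) / Δ * M Δ (-t) := by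
  refine and_congr_right fun ht => ?_
  have hM := M_pos h0 h1 (s := -t) (by linarith [radius_pos h0 h1])
  rw [neg_div, neg_add_eq_zero, div_eq_iff hM.ne', div_div]

lemma isLeftPoint_iff (h0 : 0 < Δ) (h1 : Δ < 1) {ε t : ℝ} : IsLeftPoint Δ ε t ↔
    0 < t ∧ t < radius Δ ∧ M' Δ t = 1 / (1 - ε) ^ (1 / Δ) / Δ * M Δ t := by
  refine and_congr_right fun _ => and_congr_right fun ht => ?_
  have hM := M_pos h0 h1 ht
  rw [neg_add_eq_zero, div_eq_iff hM.ne', div_div]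

lemma one_add_le_rpow (h0 : 0 < Δ) (h1 : Δ < 1) (hν : 0 < ν) :
    1 + ν ≤ (1 + ν * Δ) ^ (1 / Δ) := by
  have h := one_add_mul_self_le_rpow_one_add (s := ν * Δ) (p := 1 / Δ)
    (by nlinarith) (by rw [le_div_iff₀ h0]; linarith)
  rwa [show 1 / Δ * (ν * Δ) = ν by field_simp] at h

lemma rpow_le_exp {x : ℝ} (h0 : 0 < Δ) (hx : 0 ≤ 1 + x * Δ) :
    (1 + x * Δ) ^ (1 / Δ) ≤ Real.exp x := by
  calc (1 + x * Δ) ^ (1 / Δ) ≤ Real.exp (x * Δ) ^ (1 / Δ) := by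
        gcongr
        linarith [Real.add_one_le_exp (x * Δ)]
    _ = Real.exp x := by
        rw [← Real.exp_mul]
        congr 1
        field_simp

/-- With `u = (1 + νΔ) ^ (1/Δ)` the target value of `M' / M` is `1 / (uΔ)`, and `1 + ν ≤ u ≤ exp ν`
uniformly in `Δ`. At `0` the quotient is `1/Δ`, too large; at `-uΔ` it is at most `1 / (Δ + uΔ)`,
too small. -/
lemma exists_rightPoint (h0 : 0 < Δ) (h1 : Δ < 1) (hν : 0 < ν) (hν1 : ν < 1) :
    ∃ t, (∀ t', IsRightPoint Δ (ν * Δ) t' ↔ t' = t) ∧ 0 < t ∧ (ν < 1 / 4 → t < radius Δ) ∧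
      ν ^ 2 / 96 ≤ rightRate Δ (ν * Δ) t ∧ rightRate Δ (ν * Δ) t ≤ 2 := by
  have hr := radius_pos h0 h1
  have hu := one_add_le_rpow h0 h1 hν
  have hue := rpow_le_exp (x := ν) h0 (by positivity)
  simp only [isRightPoint_iff h0 h1]
  set u := (1 + ν * Δ) ^ (1 / Δ) with hu_def
  have hu0 : 0 < u := by linarith
  have hy1 : 1 / u < 1 := by rw [div_lt_one hu0]; linarith
  have hy0 : 0 < 1 / u := by positivity
  have hne : 1 / u / Δ ≠ 1 / Δ := (div_lt_div_of_pos_right hy1 h0).ne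
  obtain ⟨s, hs, hMs⟩ : ∃ s ∈ Set.Ioo (-(u * Δ)) 0, M' Δ s = 1 / u / Δ * M Δ s := by
    refine exists_saddle h0 h1 (by rw [neg_nonpos]; positivity) hr ?_ ?_
    · have h := M'_neg_le h0 h1 (t := u * Δ) (by positivity)
      have hM := M_pos h0 h1 (s := -(u * Δ)) (by have : 0 < u * Δ := by positivity
                                                 linarith)
      rw [← le_div_iff₀ (by positivity)] at h
      refine h.trans_lt ?_
      rw [div_eq_mul_one_div, mul_comm, div_div]
      refine mul_lt_mul_of_pos_right ?_ hM
      exact one_div_lt_one_div_of_lt (by positivity) (by linarith)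
    · rw [M_zero, M'_zero h0 h1, mul_one]
      exact div_lt_div_of_pos_right hy1 h0
  obtain ⟨t, rfl⟩ : ∃ t, s = -t := ⟨-s, by ring⟩
  have ht : 0 < t := by linarith [hs.2]
  have htr : -t < radius Δ := by linarith
  have hM := M_pos h0 h1 htr
  -- This yields `t ≤ (exp ν - 1) Δ`. For `ν < 1/4` that is at most `0.3 Δ`, below `Δ / e ≤ radius
  -- Δ`.
  have hbound : Δ + t ≤ u * Δ := by
    have h := M'_neg_le h0 h1 ht.le
    rw [hMs, mul_right_comm] at h
    have h2 := (mul_le_iff_le_one_left hM).1 h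
    rwa [div_div, one_div_mul_eq_div, div_le_one (by positivity)] at h2
  have e : rightRate Δ (ν * Δ) t = -Real.log (M Δ (-t)) + (-t) * (1 / u / Δ) := by
    rw [rightRate, ← hu_def, div_div]
    ring
  refine ⟨t, fun t' => ⟨fun ⟨h, h'⟩ => ?_, ?_⟩, ht, fun hν4 => ?_, ?_, ?_⟩
  · exact neg_injective (saddle_unique h0 h1 hne (by linarith) htr h' hMs)
  · rintro rfl
    exact ⟨ht, hMs⟩
  · have hlt := mul_exp_neg_one_le_radius h0 h1
    have h3 := Real.exp_one_lt_d9
    have h4 : (2.7182818286 : ℝ)⁻¹ < (Real.exp 1)⁻¹ := by gcongr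
    have h5 : Real.exp ν ≤ 1.3 := by
      have hb := Real.exp_bound' (x := ν) hν.le hν1.le (n := 3) (by norm_num)
      norm_num [Finset.sum_range_succ, Nat.factorial] at hb
      nlinarith [pow_pos hν 2, pow_pos hν 3, mul_pos hν (sub_pos.2 hν4)]
    rw [Real.exp_neg] at hlt
    norm_num at h4
    nlinarith
  · rw [e]
    have hz : 0 < 1 - 1 / u := by linarith
    -- This `τ` maximises `τ (1/u - 1) - 6τ²`, with value `(1 - 1/u)² / 24`; since `1 - 1/u ≥ ν/2`,
    -- this is at least `ν² / 96`.
    have h := le_rate h0 h1 htr hMs (τ := -((1 - 1 / u) / 12))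
      (by rw [abs_neg, abs_of_pos (by positivity)]; linarith)
    refine le_trans ?_ h
    have h2 : ν / 2 ≤ 1 - 1 / u := by
      rw [le_sub_comm, div_le_iff₀ hu0]
      nlinarith
    nlinarith
  · rw [e]
    have hl : 1 / (1 + t / Δ) ≤ M Δ (-t) := by
      have := le_M h0 h1 htr
      rwa [neg_div, sub_neg_eq_add] at this
    have h3 := Real.log_le_log (by positivity) hl
    rw [Real.log_div one_ne_zero (by positivity), Real.log_one, zero_sub] at h3
    have h4 := Real.log_le_sub_one_of_pos (show 0 < 1 + t / Δ by positivity)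
    have h5 : t / Δ ≤ 2 := by
      rw [div_le_iff₀ h0]
      have := Real.exp_one_lt_three
      have : Real.exp ν ≤ Real.exp 1 := Real.exp_le_exp.2 hν1.le
      nlinarith
    have h6 : 0 < t * (1 / u / Δ) := by positivity
    linarith

/-- Now `M' / M` must reach a value above its value `1/Δ` at `0`. By `M_sq_le` it is at least `(M(b)
- 1) / b` at `b`, which suffices once `b` is close enough to the radius for `M(b)` to be large. -/
lemma exists_leftPoint (h0 : 0 < Δ) (h1 : Δ < 1) (hν : 0 < ν) (hν1 : ν < 1) :
    ∃ t, (∀ t', IsLeftPoint Δ (ν * Δ) t' ↔ t' = t) ∧ 0 < t ∧ t < radius Δ ∧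
      ν ^ 2 / 24 ≤ leftRate Δ (ν * Δ) t ∧ (Δ ≤ 1 / 2 → leftRate Δ (ν * Δ) t ≤ 9) := by
  have hr := radius_pos h0 h1
  have hνΔ : ν * Δ < 1 := by nlinarith
  have hue := rpow_le_exp (x := -ν) h0 (by linarith)
  rw [neg_mul, ← sub_eq_add_neg] at hue
  simp only [isLeftPoint_iff h0 h1]
  set u := (1 - ν * Δ) ^ (1 / Δ) with hu_def
  have hu0 : 0 < u := Real.rpow_pos_of_pos (by linarith) _
  have hy : 1 + ν ≤ 1 / u := by
    rw [le_div_iff₀ hu0]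
    calc (1 + ν) * u ≤ Real.exp ν * Real.exp (-ν) := by
          gcongr
          linarith [Real.add_one_le_exp ν]
      _ = 1 := by rw [← Real.exp_add]; simp
  have hy1 : 1 < 1 / u := by linarith
  have hne : 1 / u / Δ ≠ 1 / Δ := (div_lt_div_of_pos_right hy1 h0).ne'
  obtain ⟨b, hb0, hbr, hb⟩ := exists_lt_M h0 h1 (1 + radius Δ * (1 / u / Δ))
  obtain ⟨t, ⟨ht, htb⟩, hMt⟩ : ∃ s ∈ Set.Ioo 0 b, M' Δ s = 1 / u / Δ * M Δ s := by
    refine exists_saddle h0 h1 hb0.le hbr ?_ ?_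
    · rw [M_zero, M'_zero h0 h1, mul_one]
      exact div_lt_div_of_pos_right hy1 h0
    · have hM := M_pos h0 h1 hbr
      have h := M_sq_le h0 h1 hbr
      have hY : 0 < 1 / u / Δ := by positivity
      have h2 : b * (1 / u / Δ * M Δ b) < b * M' Δ b := by
        nlinarith [mul_pos (sub_pos.2 hbr) hY]
      exact lt_of_mul_lt_mul_left h2 hb0.le
  have htr : t < radius Δ := htb.trans hbr
  have e : leftRate Δ (ν * Δ) t = -Real.log (M Δ t) + t * (1 / u / Δ) := by
    rw [leftRate, ← hu_def, div_div]
    ring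
  refine ⟨t, fun t' => ⟨fun ⟨h, h', h''⟩ => ?_, ?_⟩, ht, htr, ?_, fun hΔ => ?_⟩
  · exact saddle_unique h0 h1 hne h' htr h'' hMt
  · rintro rfl
    exact ⟨ht, htr, hMt⟩
  · rw [e]
    have h := le_rate h0 h1 htr hMt (τ := ν / 12) (by rw [abs_of_pos (by positivity)]; linarith)
    refine le_trans ?_ h
    nlinarith
  · rw [e]
    have hM : 0 ≤ Real.log (M Δ t) := by
      refine Real.log_nonneg ((le_M h0 h1 htr).trans' ?_)
      have hlt : t / Δ < 1 := by rw [div_lt_one h0]; exact htr.trans_le (radius_le h0 h1)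
      rw [le_div_iff₀ (by linarith)]
      have : 0 < t / Δ := by positivity
      linarith
    -- For `Δ ≤ 1/2` one has `log (1 - νΔ) ≥ -2Δ`, hence `u ≥ exp (-2)`. The restriction keeps `1 -
    -- νΔ` away from `0`.
    have hu9 : 1 / u ≤ 9 := by
      have hl := Real.one_sub_inv_le_log_of_pos (show 0 < 1 - ν * Δ by linarith)
      have hexp : Real.exp (-2) ≤ u := by
        rw [hu_def, Real.rpow_def_of_pos (by linarith)]
        refine Real.exp_le_exp.2 ?_
        rw [mul_one_div, le_div_iff₀ h0]
        refine le_trans ?_ hl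
        have hhalf : ν * Δ ≤ 1 / 2 := by nlinarith
        rw [le_sub_iff_add_le, ← le_sub_iff_add_le', inv_eq_one_div, div_le_iff₀ (by linarith)]
        nlinarith
      have h9 : Real.exp 2 ≤ 9 := by
        have := Real.exp_one_lt_three
        rw [show (2 : ℝ) = 1 + 1 by norm_num, Real.exp_add]
        nlinarith [Real.exp_pos 1]
      calc 1 / u ≤ 1 / Real.exp (-2) := by gcongr
        _ = Real.exp 2 := by rw [Real.exp_neg]; simp
        _ ≤ 9 := h9
    have : t * (1 / u / Δ) ≤ 1 * (1 / u) := by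
      rw [mul_div_assoc', mul_comm, div_le_iff₀ h0]
      nlinarith [radius_le h0 h1]
    linarith

/-! ### The law of the projected data -/

/-- The joint law of the entries that enter one sample. -/
abbrev columnLaw (D : ℕ) : Measure (Fin D → ℝ × ℝ) := Measure.pi fun _ => sourceLaw

/-- Independence is given for one flat family indexed by `S ⊕ S`; it is regrouped into independent
columns of independent pairs. The maps `φ` and `ψ` are inverse rearrangements of coordinates, and
`φ` is checked on product sets. -/
lemma hasLaw_columns {Ω : Type*} [MeasurableSpace Ω] {μ : Measure Ω} {D k : ℕ}
    {v w : Fin D → Fin k → Ω → ℝ} (h : IsSource μ v w) :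
    HasLaw (fun ω (j : Fin k) (i : Fin D) => (v i j ω, w i j ω))
      (Measure.pi fun _ => columnLaw D) μ := by
  let S := Fin D × Fin k
  let laws : S ⊕ S → Measure ℝ := Sum.elim (fun _ => uniformLaw) fun _ => expMeasure 1
  have hprob (x : S ⊕ S) : IsProbabilityMeasure (laws x) := by
    rcases x with x | x
    · exact inferInstanceAs (IsProbabilityMeasure uniformLaw)
    · exact inferInstanceAs (IsProbabilityMeasure (expMeasure 1))
  have hjoint := h.indep.hasLaw_pi (μ := laws) (by
    rintro (p | p)
    · exact h.law_v p.1 p.2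
    · exact h.law_w p.1 p.2)
  let φ : (Fin k → Fin D → ℝ × ℝ) → (S ⊕ S → ℝ) := fun z =>
    Sum.elim (fun p => (z p.2 p.1).1) fun p => (z p.2 p.1).2
  let ψ : (S ⊕ S → ℝ) → (Fin k → Fin D → ℝ × ℝ) := fun x j i =>
    (x (Sum.inl (i, j)), x (Sum.inr (i, j)))
  have hφ : Measurable φ := by
    refine measurable_pi_iff.2 ?_
    rintro (p | p)
    · exact measurable_fst.comp ((measurable_pi_apply p.1).comp (measurable_pi_apply p.2))
    · exact measurable_snd.comp ((measurable_pi_apply p.1).comp (measurable_pi_apply p.2))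
  have hψ : Measurable ψ := by fun_prop
  have hmap : (Measure.pi fun _ : Fin k => columnLaw D).map φ = Measure.pi laws := by
    symm
    refine Measure.pi_eq fun s hs => ?_
    rw [Measure.map_apply hφ (MeasurableSet.univ_pi hs)]
    have hpre : φ ⁻¹' (Set.univ.pi s) = Set.univ.pi fun j : Fin k => Set.univ.pi fun i : Fin D =>
        s (Sum.inl (i, j)) ×ˢ s (Sum.inr (i, j)) := by
      ext z
      simp only [Set.mem_preimage, Set.mem_pi, Set.mem_univ, true_implies, Set.mem_prod]
      constructor
      · exact fun h j i => ⟨h (Sum.inl (i, j)), h (Sum.inr (i, j))⟩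
      · rintro h (p | p)
        · exact (h p.2 p.1).1
        · exact (h p.2 p.1).2
    rw [hpre, Measure.pi_pi]
    simp only [Measure.pi_pi, Measure.prod_prod, Fintype.prod_sum_type,
      Finset.prod_mul_distrib, laws, Sum.elim_inl, Sum.elim_inr]
    congr 1
    · exact (Fintype.prod_prod_type_right fun p : S => uniformLaw (s (Sum.inl p))).symm
    · exact (Fintype.prod_prod_type_right fun p : S => expMeasure 1 (s (Sum.inr p))).symm
  have hae : AEMeasurable (fun ω (j : Fin k) (i : Fin D) => (v i j ω, w i j ω)) μ :=
    aemeasurable_pi_iff.2 fun j => aemeasurable_pi_iff.2 fun i =>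
      (h.law_v i j).aemeasurable.prodMk (h.law_w i j).aemeasurable
  refine ⟨hae, ?_⟩
  have hcomp : (fun ω (j : Fin k) (i : Fin D) => (v i j ω, w i j ω)) = ψ ∘ fun ω x =>
      Sum.elim (fun p : S => v p.1 p.2) (fun p : S => w p.1 p.2) x ω := rfl
  rw [hcomp, ← AEMeasurable.map_map_of_aemeasurable hψ.aemeasurable hjoint.aemeasurable,
    hjoint.map_eq, ← hmap, Measure.map_map hψ hφ]
  exact Measure.map_id

/-- One sample, as a function of the entries of one column of the projection matrix. -/
def sample {D : ℕ} (Δ : ℝ) (A : Fin D → ℝ) (z : Fin D → ℝ × ℝ) : ℝ :=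
  ∑ i, stableGen Δ (z i).1 (z i).2 * A i

variable {D : ℕ} {A : Fin D → ℝ}

lemma measurable_sample (Δ : ℝ) (A : Fin D → ℝ) : Measurable (sample Δ A) :=
  Finset.measurable_fun_sum _ fun i _ =>
    ((measurable_stableGen Δ).comp (measurable_pi_apply i)).mul_const _

lemma ae_columnLaw_pos (h0 : 0 < Δ) (h1 : Δ < 1) :
    ∀ᵐ z ∂columnLaw D, ∀ i, 0 < stableGen Δ (z i).1 (z i).2 := by
  refine ae_all_iff.2 fun i => ?_
  have h : ∀ᵐ p ∂sourceLaw, 0 < stableGen Δ p.1 p.2 := by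
    filter_upwards [ae_sourceLaw] with p ⟨hv, hw⟩ using stableGen_pos h0 h1 hv hw
  exact (Measure.quasiMeasurePreserving_eval (fun _ : Fin D => sourceLaw) i).ae h

lemma exists_pos_of_ne_zero (hA : ∀ i, 0 ≤ A i) (hA0 : A ≠ 0) : ∃ i, 0 < A i := by
  obtain ⟨i, hi⟩ := Function.ne_iff.1 hA0
  exact ⟨i, lt_of_le_of_ne (hA i) (Ne.symm hi)⟩

lemma ae_sample_pos (h0 : 0 < Δ) (h1 : Δ < 1) (hA : ∀ i, 0 ≤ A i) (hA0 : A ≠ 0) :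
    ∀ᵐ z ∂columnLaw D, 0 < sample Δ A z := by
  obtain ⟨i, hi⟩ := exists_pos_of_ne_zero hA hA0
  filter_upwards [ae_columnLaw_pos h0 h1] with z hz
  exact Finset.sum_pos' (fun j _ => mul_nonneg (hz j).le (hA j))
    ⟨i, Finset.mem_univ i, mul_pos (hz i) hi⟩

lemma moment_pos (hA : ∀ i, 0 ≤ A i) (hA0 : A ≠ 0) : 0 < moment Δ A := by
  obtain ⟨i, hi⟩ := exists_pos_of_ne_zero hA hA0
  exact Finset.sum_pos' (fun j _ => Real.rpow_nonneg (hA j) _)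
    ⟨i, Finset.mem_univ i, Real.rpow_pos_of_pos hi _⟩

/-- Stability: the Laplace transform of a sample. -/
lemma lintegral_exp_neg_sample (h0 : 0 < Δ) (h1 : Δ < 1) (hA : ∀ i, 0 ≤ A i) {l : ℝ}
    (hl : 0 ≤ l) : ∫⁻ z, ENNReal.ofReal (Real.exp (-(l * sample Δ A z))) ∂columnLaw D =
      ENNReal.ofReal (Real.exp (-moment Δ A * l ^ (1 - Δ))) := by
  let f (i : Fin D) (p : ℝ × ℝ) : ENNReal :=
    ENNReal.ofReal (Real.exp (-(l * A i * stableGen Δ p.1 p.2)))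
  have hf (i : Fin D) : Measurable (f i) := by
    have := measurable_stableGen Δ
    fun_prop
  have h := lintegral_prod_eq_prod_lintegral_of_indepFun Finset.univ
    (fun i (z : Fin D → ℝ × ℝ) => f i (z i))
    (iIndepFun_pi (μ := fun _ => sourceLaw) fun i => (hf i).aemeasurable)
    (fun i => (hf i).comp (measurable_pi_apply i))
  have e1 (z : Fin D → ℝ × ℝ) : ∏ i, f i (z i) =
      ENNReal.ofReal (Real.exp (-(l * sample Δ A z))) := by
    rw [← ENNReal.ofReal_prod_of_nonneg fun i _ => (Real.exp_pos _).le, ← Real.exp_sum, sample,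
      Finset.mul_sum, ← Finset.sum_neg_distrib]
    congr 2
    exact Finset.sum_congr rfl fun i _ => by ring
  have e2 (i : Fin D) : ∫⁻ z, f i (z i) ∂columnLaw D =
      ENNReal.ofReal (Real.exp (-(l * A i) ^ (1 - Δ))) := by
    rw [(measurePreserving_eval (fun _ : Fin D => sourceLaw) i).lintegral_comp (hf i)]
    exact lintegral_exp_neg_stableGen h0 h1 (mul_nonneg hl (hA i))
  simp only [e1, e2] at h
  rw [h, ← ENNReal.ofReal_prod_of_nonneg fun i _ => (Real.exp_pos _).le, ← Real.exp_sum,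
    Finset.sum_neg_distrib, moment, neg_mul, Finset.sum_mul]
  congr 3
  exact Finset.sum_congr rfl fun i _ => by rw [Real.mul_rpow hl (hA i), mul_comm]

/-- The normalised statistic of one sample. -/
def sampleStatistic (Δ : ℝ) (A : Fin D → ℝ) (z : Fin D → ℝ × ℝ) : ℝ :=
  moment Δ A ^ (1 / Δ) * sample Δ A z ^ (-(1 - Δ) / Δ)

lemma measurable_sampleStatistic (Δ : ℝ) (A : Fin D → ℝ) : Measurable (sampleStatistic Δ A) :=
  ((measurable_sample Δ A).pow_const _).const_mul _

/-- Neither `D` nor `A` survives on the right, so one function `M` governs the tails for every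
vector. -/
lemma map_sampleStatistic (h0 : 0 < Δ) (h1 : Δ < 1) (hA : ∀ i, 0 ≤ A i) (hA0 : A ≠ 0) :
    (columnLaw D).map (sampleStatistic Δ A) = sourceLaw.map (statistic Δ) := by
  have hm := measurable_sample Δ A
  have := Measure.isProbabilityMeasure_map (μ := columnLaw D) hm.aemeasurable
  rw [← map_rpow_of_laplace h0 h1 (κ := (columnLaw D).map (sample Δ A))
    (moment_pos (Δ := Δ) hA hA0), Measure.map_map (by fun_prop) hm]
  · rfl
  · rw [ae_map_iff hm.aemeasurable measurableSet_Ioi]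
    exact ae_sample_pos h0 h1 hA hA0
  · intro l hl
    rw [lintegral_map (by fun_prop) hm]
    exact lintegral_exp_neg_sample h0 h1 hA hl.le

/-! ### Tail bounds -/

section Tails

variable {k : ℕ}

lemma integrable_exp_sampleStatistic (h0 : 0 < Δ) (h1 : Δ < 1) (hA : ∀ i, 0 ≤ A i) (hA0 : A ≠ 0)
    {s : ℝ} (hs : s < radius Δ) :
    Integrable (fun z => Real.exp (s * sampleStatistic Δ A z)) (columnLaw D) := by
  have hm := measurable_sampleStatistic Δ A
  have h := (integrable_map_measure (μ := sourceLaw) (f := statistic Δ)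
    (g := fun x => Real.exp (s * x)) (by fun_prop) (measurable_statistic Δ).aemeasurable).2
    (integrable_exp_statistic h0 h1 hs)
  rw [← map_sampleStatistic h0 h1 hA hA0] at h
  exact (integrable_map_measure (by fun_prop) hm.aemeasurable).1 h

lemma integral_exp_sampleStatistic (h0 : 0 < Δ) (h1 : Δ < 1) (hA : ∀ i, 0 ≤ A i) (hA0 : A ≠ 0)
    (s : ℝ) : ∫ z, Real.exp (s * sampleStatistic Δ A z) ∂columnLaw D = M Δ s := by
  rw [← integral_map (μ := columnLaw D) (f := fun x => Real.exp (s * x))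
    (measurable_sampleStatistic Δ A).aemeasurable (by fun_prop), map_sampleStatistic h0 h1 hA hA0,
    integral_map (measurable_statistic Δ).aemeasurable (by fun_prop)]
  rfl

/-- The sum of the normalised statistics of all samples. -/
def sumStatistic (Δ : ℝ) (A : Fin D → ℝ) (z : Fin k → Fin D → ℝ × ℝ) : ℝ :=
  ∑ j, sampleStatistic Δ A (z j)

lemma sumStatistic_eq (Δ : ℝ) (A : Fin D → ℝ) : sumStatistic (k := k) Δ A =
    ∑ j, fun z => sampleStatistic Δ A (z j) := by
  ext z
  simp [sumStatistic]

lemma integrable_exp_sumStatistic (h0 : 0 < Δ) (h1 : Δ < 1) (hA : ∀ i, 0 ≤ A i) (hA0 : A ≠ 0)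
    {s : ℝ} (hs : s < radius Δ) : Integrable (fun z => Real.exp (s * sumStatistic Δ A z))
      (Measure.pi fun _ : Fin k => columnLaw D) := by
  have hm := measurable_sampleStatistic Δ A
  rw [sumStatistic_eq]
  refine iIndepFun.integrable_exp_mul_sum (iIndepFun_pi fun _ => hm.aemeasurable)
    (fun j => hm.comp (measurable_pi_apply j)) fun j _ => ?_
  exact (measurePreserving_eval (fun _ : Fin k => columnLaw D) j).integrable_comp_of_integrable
    (integrable_exp_sampleStatistic h0 h1 hA hA0 hs)

lemma mgf_sumStatistic (h0 : 0 < Δ) (h1 : Δ < 1) (hA : ∀ i, 0 ≤ A i) (hA0 : A ≠ 0) (s : ℝ) :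
    mgf (sumStatistic Δ A) (Measure.pi fun _ : Fin k => columnLaw D) s = M Δ s ^ k := by
  have hm := measurable_sampleStatistic Δ A
  rw [sumStatistic_eq, iIndepFun.mgf_sum (iIndepFun_pi fun _ => hm.aemeasurable)
    (fun j => hm.comp (measurable_pi_apply j)), Finset.prod_congr rfl fun j _ => ?_]
  · rw [Finset.prod_const, Finset.card_univ, Fintype.card_fin]
  · have hf : AEStronglyMeasurable (fun x => Real.exp (s * sampleStatistic Δ A x)) (columnLaw D) :=
      (by fun_prop : Measurable _).aestronglyMeasurable
    rw [← integral_exp_sampleStatistic h0 h1 hA hA0 s, mgf]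
    exact integral_comp_eval (μ := fun _ : Fin k => columnLaw D) (i := j) hf

lemma exp_mul_pow_eq (h0 : 0 < Δ) (h1 : Δ < 1) {s : ℝ} (hs : s < radius Δ) (y : ℝ) :
    Real.exp (-s * (k * y)) * M Δ s ^ k =
      Real.exp (-((k : ℝ) * (-Real.log (M Δ s) + s * y))) := by
  have hM := M_pos h0 h1 hs
  rw [← Real.exp_log (pow_pos hM k), ← Real.exp_add, Real.log_pow]
  congr 1
  ring

lemma tail_le (h0 : 0 < Δ) (h1 : Δ < 1) (hA : ∀ i, 0 ≤ A i) (hA0 : A ≠ 0) {s : ℝ} (hs : s ≤ 0)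
    (y : ℝ) : (Measure.pi fun _ : Fin k => columnLaw D).real {z | sumStatistic Δ A z ≤ k * y} ≤
      Real.exp (-((k : ℝ) * (-Real.log (M Δ s) + s * y))) := by
  have hr := hs.trans_lt (radius_pos h0 h1)
  rw [← exp_mul_pow_eq h0 h1 hr, ← mgf_sumStatistic h0 h1 hA hA0]
  exact measure_le_le_exp_mul_mgf _ hs (integrable_exp_sumStatistic h0 h1 hA hA0 hr)

lemma tail_ge (h0 : 0 < Δ) (h1 : Δ < 1) (hA : ∀ i, 0 ≤ A i) (hA0 : A ≠ 0) {s : ℝ} (hs : 0 ≤ s)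
    (hr : s < radius Δ) (y : ℝ) :
    (Measure.pi fun _ : Fin k => columnLaw D).real {z | k * y ≤ sumStatistic Δ A z} ≤
      Real.exp (-((k : ℝ) * (-Real.log (M Δ s) + s * y))) := by
  rw [← exp_mul_pow_eq h0 h1 hr, ← mgf_sumStatistic h0 h1 hA hA0]
  exact measure_ge_le_exp_mul_mgf _ hs (integrable_exp_sumStatistic h0 h1 hA hA0 hr)

/-- After normalisation the estimator is `F` times a decreasing function of the sum of statistics,
so its upper tail is the lower tail of the sum and conversely. -/
lemma estimator_eq (h0 : 0 < Δ) {F : ℝ} (hF : 0 < F) (hk : 0 < k) {x : Fin k → ℝ}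
    (hx : ∀ j, 0 < x j) : 0 < ∑ j, F ^ (1 / Δ) * x j ^ (-(1 - Δ) / Δ) ∧ estimator Δ x =
      F * (k / (Δ * ∑ j, F ^ (1 / Δ) * x j ^ (-(1 - Δ) / Δ))) ^ Δ := by
  have : Nonempty (Fin k) := ⟨⟨0, hk⟩⟩
  have hT : 0 < ∑ j, x j ^ (-(1 - Δ) / Δ) :=
    Finset.sum_pos (fun j _ => Real.rpow_pos_of_pos (hx j) _) Finset.univ_nonempty
  rw [← Finset.mul_sum]
  refine ⟨by positivity, ?_⟩
  have hk' : (0 : ℝ) < k := by exact_mod_cast hk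
  rw [estimator]
  generalize ∑ j, x j ^ (-(1 - Δ) / Δ) = T at *
  have e : F = (F ^ (1 / Δ)) ^ Δ := by
    rw [← Real.rpow_mul hF.le, one_div_mul_cancel h0.ne', Real.rpow_one]
  nth_rewrite 1 [e]
  rw [← Real.mul_rpow (by positivity) (by positivity), ← Real.one_rpow Δ,
    ← Real.div_rpow zero_le_one h0.le, ← Real.mul_rpow (by positivity) (by positivity),
    Real.one_rpow]
  congr 1
  field_simp

lemma le_estimator_iff (h0 : 0 < Δ) {F c : ℝ} (hF : 0 < F) (hc : 0 < c) (hk : 0 < k)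
    {x : Fin k → ℝ} (hx : ∀ j, 0 < x j) : c * F ≤ estimator Δ x ↔
      ∑ j, F ^ (1 / Δ) * x j ^ (-(1 - Δ) / Δ) ≤ k * (1 / c ^ (1 / Δ) / Δ) := by
  obtain ⟨hS, e⟩ := estimator_eq h0 hF hk hx
  have hk' : (0 : ℝ) < k := by exact_mod_cast hk
  generalize ∑ j, F ^ (1 / Δ) * x j ^ (-(1 - Δ) / Δ) = S at *
  have hcp : 0 < c ^ (1 / Δ) := by positivity
  have e2 : c = (c ^ (1 / Δ)) ^ Δ := by
    rw [← Real.rpow_mul hc.le, one_div_mul_cancel h0.ne', Real.rpow_one]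
  rw [e, mul_comm c, mul_le_mul_iff_right₀ hF]
  nth_rewrite 1 [e2]
  rw [Real.rpow_le_rpow_iff hcp.le (by positivity) h0, le_div_iff₀ (by positivity), div_div,
    mul_one_div, le_div_iff₀ (by positivity)]
  ring_nf

lemma estimator_le_iff (h0 : 0 < Δ) {F c : ℝ} (hF : 0 < F) (hc : 0 < c) (hk : 0 < k)
    {x : Fin k → ℝ} (hx : ∀ j, 0 < x j) : estimator Δ x ≤ c * F ↔
      k * (1 / c ^ (1 / Δ) / Δ) ≤ ∑ j, F ^ (1 / Δ) * x j ^ (-(1 - Δ) / Δ) := by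
  obtain ⟨hS, e⟩ := estimator_eq h0 hF hk hx
  have hk' : (0 : ℝ) < k := by exact_mod_cast hk
  generalize ∑ j, F ^ (1 / Δ) * x j ^ (-(1 - Δ) / Δ) = S at *
  have hcp : 0 < c ^ (1 / Δ) := by positivity
  have e2 : c = (c ^ (1 / Δ)) ^ Δ := by
    rw [← Real.rpow_mul hc.le, one_div_mul_cancel h0.ne', Real.rpow_one]
  rw [e, mul_comm c, mul_le_mul_iff_right₀ hF]
  nth_rewrite 1 [e2]
  rw [Real.rpow_le_rpow_iff (by positivity) hcp.le h0, div_le_iff₀ (by positivity), div_div,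
    mul_one_div, div_le_iff₀ (by positivity)]
  ring_nf

lemma ae_samples_pos (h0 : 0 < Δ) (h1 : Δ < 1) (hA : ∀ i, 0 ≤ A i) (hA0 : A ≠ 0) :
    ∀ᵐ z ∂(Measure.pi fun _ : Fin k => columnLaw D), ∀ j, 0 < sample Δ A (z j) :=
  ae_all_iff.2 fun j => (Measure.quasiMeasurePreserving_eval (fun _ : Fin k => columnLaw D) j).ae
    (ae_sample_pos h0 h1 hA hA0)

lemma measurable_estimator (Δ : ℝ) (A : Fin D → ℝ) :
    Measurable fun z : Fin k → Fin D → ℝ × ℝ => estimator Δ fun j => sample Δ A (z j) := by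
  have hm := measurable_sample Δ A
  unfold estimator
  fun_prop

variable {Ω : Type*} [MeasurableSpace Ω] {μ : Measure Ω} [IsProbabilityMeasure μ]
  {v w : Fin D → Fin k → Ω → ℝ}

lemma right_tail (h : IsSource μ v w) (h0 : 0 < Δ) (h1 : Δ < 1) (hA : ∀ i, 0 ≤ A i)
    (hA0 : A ≠ 0) {c s : ℝ} (hc : 0 < c) (hs : s ≤ 0) :
    μ.real {ω | c * moment Δ A ≤ estimator Δ (project (projMatrix Δ v w ω) A)} ≤
      Real.exp (-((k : ℝ) * (-Real.log (M Δ s) + s * (1 / c ^ (1 / Δ) / Δ)))) := by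
  -- Without samples the bound is `exp 0 = 1`.
  rcases Nat.eq_zero_or_pos k with rfl | hk
  · simp
  refine le_trans (le_of_eq_of_le ((hasLaw_columns h).measureReal_eq (p := fun z => c * moment Δ A ≤
      estimator Δ fun j => sample Δ A (z j))
    (measurableSet_le measurable_const (measurable_estimator Δ A))) ?_)
    (tail_le (k := k) h0 h1 hA hA0 hs _)
  refine ENNReal.toReal_mono (by finiteness) (measure_mono_ae ?_)
  filter_upwards [ae_samples_pos h0 h1 hA hA0] with z hz
  exact (le_estimator_iff h0 (moment_pos hA hA0) hc hk hz).1

lemma left_tail (h : IsSource μ v w) (h0 : 0 < Δ) (h1 : Δ < 1) (hA : ∀ i, 0 ≤ A i)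
    (hA0 : A ≠ 0) {c s : ℝ} (hc : 0 < c) (hs : 0 ≤ s) (hr : s < radius Δ) :
    μ.real {ω | estimator Δ (project (projMatrix Δ v w ω) A) ≤ c * moment Δ A} ≤
      Real.exp (-((k : ℝ) * (-Real.log (M Δ s) + s * (1 / c ^ (1 / Δ) / Δ)))) := by
  rcases Nat.eq_zero_or_pos k with rfl | hk
  · simp
  refine le_trans (le_of_eq_of_le ((hasLaw_columns h).measureReal_eq (p := fun z =>
      (estimator Δ fun j => sample Δ A (z j)) ≤ c * moment Δ A)
    (measurableSet_le (measurable_estimator Δ A) measurable_const)) ?_)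
    (tail_ge (k := k) h0 h1 hA hA0 hs hr _)
  refine ENNReal.toReal_mono (by finiteness) (measure_mono_ae ?_)
  filter_upwards [ae_samples_pos h0 h1 hA hA0] with z hz
  exact (estimator_le_iff h0 (moment_pos hA hA0) hc hk hz).1

end Tails

end

section

variable {Δ ν : ℝ} {D k : ℕ}

/-! ### Concentration -/

section Concentration

variable {Ω : Type*} [MeasurableSpace Ω] {μ : Measure Ω} [IsProbabilityMeasure μ]
  {v w : Fin D → Fin k → Ω → ℝ}

lemma right_tail_rate (h : IsSource μ v w) (h0 : 0 < Δ) (h1 : Δ < 1) (hν : 0 < ν)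
    {A : Fin D → ℝ} (hA : ∀ i, 0 ≤ A i) (hA0 : A ≠ 0) {t : ℝ} (ht : 0 < t) :
    μ.real {ω | (1 + ν * Δ) * moment Δ A ≤ estimator Δ (project (projMatrix Δ v w ω) A)} ≤
      Real.exp (-((k : ℝ) * rightRate Δ (ν * Δ) t)) := by
  have := right_tail h h0 h1 hA hA0 (c := 1 + ν * Δ) (s := -t) (by positivity) (by linarith)
  refine this.trans_eq ?_
  rw [rightRate, div_div]
  ring_nf

lemma left_tail_rate (h : IsSource μ v w) (h0 : 0 < Δ) (h1 : Δ < 1) (hν1 : ν < 1)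
    {A : Fin D → ℝ} (hA : ∀ i, 0 ≤ A i) (hA0 : A ≠ 0) {t : ℝ} (ht : 0 < t)
    (htr : t < radius Δ) :
    μ.real {ω | estimator Δ (project (projMatrix Δ v w ω) A) ≤ (1 - ν * Δ) * moment Δ A} ≤
      Real.exp (-((k : ℝ) * leftRate Δ (ν * Δ) t)) := by
  have := left_tail h h0 h1 hA hA0 (c := 1 - ν * Δ) (s := t) (by nlinarith) ht.le htr
  refine this.trans_eq ?_
  rw [leftRate, div_div]
  ring_nf

theorem concentration (h : IsSource μ v w) (h0 : 0 < Δ) (h1 : Δ < 1) (hν : 0 < ν) (hν1 : ν < 1)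
    {δ : ℝ} (hδ : 0 < δ) (hk : 96 * Real.log (2 / δ) / ν ^ 2 ≤ k) {A : Fin D → ℝ}
    (hA : ∀ i, 0 ≤ A i) (hA0 : A ≠ 0) :
    1 - δ ≤ μ.real {ω | |estimator Δ (project (projMatrix Δ v w ω) A) - moment Δ A| ≤
      ν * Δ * moment Δ A} := by
  obtain ⟨tR, -, htR, -, hR, -⟩ := exists_rightPoint h0 h1 hν hν1
  obtain ⟨tL, -, htL, htLr, hL, -⟩ := exists_leftPoint h0 h1 hν hν1
  have hr := right_tail_rate h h0 h1 hν hA hA0 htR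
  have hl := left_tail_rate h h0 h1 hν1 hA hA0 htL htLr
  have hexp {r : ℝ} (hrate : ν ^ 2 / 96 ≤ r) : Real.exp (-((k : ℝ) * r)) ≤ δ / 2 := by
    rw [← Real.exp_log (show 0 < δ / 2 by positivity), ← inv_div, Real.log_inv]
    refine Real.exp_le_exp.2 (neg_le_neg ?_)
    rw [div_le_iff₀ (by positivity)] at hk
    have : (k : ℝ) * (ν ^ 2 / 96) ≤ k * r := by gcongr
    linarith
  have hr' := hr.trans (hexp hR)
  have hl' := hl.trans (hexp (le_trans (by nlinarith [sq_nonneg ν]) hL))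
  set S := {ω | |estimator Δ (project (projMatrix Δ v w ω) A) - moment Δ A| ≤
      ν * Δ * moment Δ A}
  set R := {ω | (1 + ν * Δ) * moment Δ A ≤ estimator Δ (project (projMatrix Δ v w ω) A)}
  set L := {ω | estimator Δ (project (projMatrix Δ v w ω) A) ≤ (1 - ν * Δ) * moment Δ A}
  have hcover : Set.univ ⊆ S ∪ (R ∪ L) := by
    intro ω _
    by_contra hn
    simp only [S, R, L, Set.mem_union, Set.mem_ofPred_eq, not_or, not_le, lt_abs] at hn
    rcases hn with ⟨h | h, h2, h3⟩ <;> linarith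
  have h2 := (measureReal_mono (μ := μ) hcover).trans
    ((measureReal_union_le S (R ∪ L)).trans
      (add_le_add_right (measureReal_union_le R L) (μ.real S)))
  rw [probReal_univ] at h2
  linarith

end Concentration

/-! ### The one-pass algorithm -/

lemma project_update (R : Fin D → Fin k → ℝ) (A : Fin D → ℝ) (i : Fin D) (x : ℝ) :
    project R (Function.update A i (A i + x)) = fun j => project R A j + x * R i j := by
  ext j
  simp only [project]
  rw [← Finset.add_sum_erase _ _ (Finset.mem_univ i),
    ← Finset.add_sum_erase _ (fun l => R l j * A l) (Finset.mem_univ i),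
    Finset.sum_congr rfl fun l hl => by rw [Function.update_of_ne (Finset.ne_of_mem_erase hl)],
    Function.update_self]
  ring

lemma total_update (A : Fin D → ℝ) (i : Fin D) (x : ℝ) :
    total (Function.update A i (A i + x)) = total A + x := by
  simp only [total]
  rw [← Finset.add_sum_erase _ _ (Finset.mem_univ i),
    ← Finset.add_sum_erase _ (fun l => A l) (Finset.mem_univ i),
    Finset.sum_congr rfl fun l hl => by rw [Function.update_of_ne (Finset.ne_of_mem_erase hl)],
    Function.update_self]
  ring

/-- The projection and the counter are linear in the vector. The induction runs over arbitrary
starting vectors, since an update changes the start. -/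
theorem sketch_eq (R : Fin D → Fin k → ℝ) (stream : List (Fin D × ℝ)) :
    sketch R stream = (project R (streamVector stream), total (streamVector stream)) := by
  have key (A : Fin D → ℝ) :
      stream.foldl (fun (s : (Fin k → ℝ) × ℝ) a => (fun j => s.1 j + a.2 * R a.1 j, s.2 + a.2))
        (project R A, total A) =
      (project R (stream.foldl (fun A a => Function.update A a.1 (A a.1 + a.2)) A),
        total (stream.foldl (fun A a => Function.update A a.1 (A a.1 + a.2)) A)) := by
    induction stream generalizing A with
    | nil => rfl
    | cons a l ih =>
      rw [List.foldl_cons, List.foldl_cons, ← ih, project_update, total_update]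
  rw [streamVector, ← key, sketch]
  congr 2
  · ext j
    simp [project]
  · simp [total]

/-! ### Entropies -/

/-- Each summand of the Tsallis entropy exceeds that of the Shannon entropy by `O(Δ)`. -/
lemma tsallis_summand_bounds (h0 : 0 < Δ) (h2 : Δ ≤ 1 / 2) {p : ℝ} (hp : 0 ≤ p) (hp1 : p ≤ 1) :
    -(p * Real.log p) * Δ ≤ p ^ (1 - Δ) - p ∧
      p ^ (1 - Δ) - p ≤ (-(p * Real.log p) + 8 * Δ) * Δ := by
  rcases hp.eq_or_lt with rfl | hp0
  · rw [Real.zero_rpow (by linarith)]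
    simp only [zero_mul, neg_zero, sub_self, zero_add, le_refl, true_and]
    positivity
  obtain ⟨L, hL, rfl⟩ : ∃ L : ℝ, 0 ≤ L ∧ p = Real.exp (-L) :=
    ⟨-Real.log p, neg_nonneg.2 (Real.log_nonpos hp hp1), by rw [neg_neg, Real.exp_log hp0]⟩
  rw [Real.log_exp, ← Real.exp_mul, show -L * (1 - Δ) = -L + Δ * L by ring, Real.exp_add]
  have hx : 0 ≤ Δ * L := by positivity
  have e1 := Real.add_one_le_exp (Δ * L)
  have e2 := Real.add_one_le_exp (-(Δ * L))
  have e3 : Real.exp (Δ * L) * Real.exp (-(Δ * L)) = 1 := by rw [← Real.exp_add]; simp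
  have hpos := Real.exp_pos (-L)
  have hpos2 := Real.exp_pos (Δ * L)
  constructor
  · nlinarith
  · have e4 : Real.exp (Δ * L) - 1 ≤ Δ * L * Real.exp (Δ * L) := by nlinarith
    have e5 : Real.exp (Δ * L) - 1 - Δ * L ≤ (Δ * L) ^ 2 * Real.exp (Δ * L) := by nlinarith
    -- As `Δ ≤ 1/2`, the exponentials are at most `exp (-L/2)`, and `exp (L/2) ≥ L²/8`.
    have e6 : L ^ 2 * (Real.exp (-L) * Real.exp (Δ * L)) ≤ 8 := by
      have hq := Real.quadratic_le_exp_of_nonneg (show 0 ≤ L / 2 by positivity)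
      have h8 : L ^ 2 ≤ 8 * Real.exp (L / 2) := by nlinarith
      calc L ^ 2 * (Real.exp (-L) * Real.exp (Δ * L))
          ≤ 8 * Real.exp (L / 2) * Real.exp (-(L / 2)) := by
            rw [← Real.exp_add]
            gcongr
            nlinarith
        _ = 8 := by rw [mul_assoc, ← Real.exp_add]; simp
    calc Real.exp (-L) * Real.exp (Δ * L) - Real.exp (-L)
        = Real.exp (-L) * (Real.exp (Δ * L) - 1 - Δ * L) + Real.exp (-L) * (Δ * L) := by ring
      _ ≤ Real.exp (-L) * ((Δ * L) ^ 2 * Real.exp (Δ * L)) + Real.exp (-L) * (Δ * L) := by gcongr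
      _ = Δ ^ 2 * (L ^ 2 * (Real.exp (-L) * Real.exp (Δ * L))) + Real.exp (-L) * (Δ * L) := by ring
      _ ≤ Δ ^ 2 * 8 + Real.exp (-L) * (Δ * L) := by gcongr
      _ = (-(Real.exp (-L) * -L) + 8 * Δ) * Δ := by ring

variable {A : Fin D → ℝ}

lemma total_pos (hA : ∀ i, 0 ≤ A i) (hA0 : A ≠ 0) : 0 < total A := by
  obtain ⟨i, hi⟩ := exists_pos_of_ne_zero hA hA0
  exact Finset.sum_pos' (fun j _ => hA j) ⟨i, Finset.mem_univ i, hi⟩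

/-- The exact Tsallis entropy is within `O(D Δ)` of the Shannon entropy. -/
lemma moment_div_bounds (h0 : 0 < Δ) (h2 : Δ ≤ 1 / 2) (hA : ∀ i, 0 ≤ A i) (hA0 : A ≠ 0) :
    1 + shannonEntropy A * Δ ≤ moment Δ A / total A ^ (1 - Δ) ∧
      moment Δ A / total A ^ (1 - Δ) ≤ 1 + (shannonEntropy A + 8 * D * Δ) * Δ ∧
      0 ≤ shannonEntropy A ∧ shannonEntropy A ≤ D := by
  have hT := total_pos hA hA0
  have hp (i : Fin D) : 0 ≤ A i / total A := div_nonneg (hA i) hT.le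
  have hp1 (i : Fin D) : A i / total A ≤ 1 :=
    (div_le_one hT).2 (Finset.single_le_sum (fun j _ => hA j) (Finset.mem_univ i))
  have hsum : ∑ i, A i / total A = 1 := by
    rw [← Finset.sum_div]
    exact div_self hT.ne'
  have eS : moment Δ A / total A ^ (1 - Δ) =
      1 + ∑ i, ((A i / total A) ^ (1 - Δ) - A i / total A) := by
    rw [Finset.sum_sub_distrib, hsum, moment, Finset.sum_div]
    simp only [Real.div_rpow (hA _) hT.le]
    ring
  have eH : shannonEntropy A = ∑ i, -(A i / total A * Real.log (A i / total A)) := by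
    rw [shannonEntropy, Finset.sum_neg_distrib]
  have hb (i : Fin D) := tsallis_summand_bounds h0 h2 (hp i) (hp1 i)
  refine ⟨?_, ?_, ?_, ?_⟩
  · rw [eS, eH, Finset.sum_mul]
    gcongr with i
    exact (hb i).1
  · have e : (shannonEntropy A + 8 * D * Δ) * Δ =
        ∑ i, (-(A i / total A * Real.log (A i / total A)) + 8 * Δ) * Δ := by
      rw [← Finset.sum_mul, Finset.sum_add_distrib, ← eH, Finset.sum_const, Finset.card_univ,
        Fintype.card_fin, nsmul_eq_mul]
      ring
    rw [eS, e]
    gcongr with i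
    exact (hb i).2
  · rw [eH]
    exact Finset.sum_nonneg fun i _ =>
      neg_nonneg.2 (mul_nonpos_of_nonneg_of_nonpos (hp i) (Real.log_nonpos (hp i) (hp1 i)))
  · rw [eH]
    calc _ ≤ ∑ _i : Fin D, (1 : ℝ) := by
          refine Finset.sum_le_sum fun i _ => ?_
          rcases (hp i).eq_or_lt with h | h
          · rw [← h]; simp
          · have := Real.one_sub_inv_le_log_of_pos h
            have h3 := mul_le_mul_of_nonneg_left this h.le
            rw [mul_sub, mul_inv_cancel₀ h.ne'] at h3
            linarith
      _ = D := by simp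

/-- Here `T` stands for the exact Tsallis entropy, `H` for the Shannon entropy and `f` for the
relative error of the moment in units of `Δ`. The logarithm splits into two, and `x - x² ≤ log (1 +
x) ≤ x` at `x = TΔ` accounts for the term `T²Δ`. -/
lemma abs_log_div_sub_le (h0 : 0 < Δ) (hν : 0 < ν) {T H f : ℝ} (hT : 0 ≤ T)
    (hf : |f| ≤ ν / 4) (hfΔ : |f * Δ| ≤ 1 / 2) (hHT : H ≤ T) (hTH : T - H + T ^ 2 * Δ ≤ ν / 2) :
    |1 / Δ * Real.log ((1 + T * Δ) * (1 + f * Δ)) - H| ≤ ν := by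
  have hTΔ : 0 ≤ T * Δ := by positivity
  have hf1 := abs_le.1 hf
  obtain ⟨hfΔ1, hfΔ2⟩ := abs_le.1 hfΔ
  have l1 := Real.log_le_sub_one_of_pos (show 0 < 1 + T * Δ by linarith)
  have l2 := Real.one_sub_inv_le_log_of_pos (show 0 < 1 + T * Δ by linarith)
  have l3 := Real.log_le_sub_one_of_pos (show 0 < 1 + f * Δ by linarith)
  have l4 := Real.one_sub_inv_le_log_of_pos (show 0 < 1 + f * Δ by linarith)
  have l2' : T * Δ - (T * Δ) ^ 2 ≤ 1 - (1 + T * Δ)⁻¹ := by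
    rw [inv_eq_one_div, le_sub_comm, div_le_iff₀ (by linarith)]
    generalize T * Δ = x at hTΔ
    have : 0 ≤ x * x ^ 2 := by positivity
    linarith
  have l4' : -(ν / 2 * Δ) ≤ 1 - (1 + f * Δ)⁻¹ := by
    rw [inv_eq_one_div, le_sub_comm, div_le_iff₀ (by linarith)]
    have h1 : -(ν / 4 * Δ) ≤ f * Δ := by
      rw [← neg_mul]
      exact mul_le_mul_of_nonneg_right (by linarith [hf1.1]) h0.le
    have h2 : 0 ≤ ν / 2 * Δ * (f * Δ + 1 / 2) := mul_nonneg (by positivity) (by linarith)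
    linarith
  rw [Real.log_mul (by linarith) (by linarith), one_div_mul_eq_div, abs_le, le_sub_iff_add_le,
    sub_le_iff_le_add, le_div_iff₀ h0, div_le_iff₀ h0]
  constructor
  · have : (H - T + T ^ 2 * Δ - ν / 2) * Δ ≤ 0 :=
      mul_nonpos_of_nonpos_of_nonneg (by linarith) h0.le
    linarith
  · have : (T + f - ν - H) * Δ ≤ 0 := by
      refine mul_nonpos_of_nonpos_of_nonneg ?_ h0.le
      have : 0 ≤ T ^ 2 * Δ := by positivity
      linarith [hf1.2]
    linarith

/-- A good estimate of the moment gives good estimates of the Shannon entropy. -/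
lemma entropy_estimates (h0 : 0 < Δ) (hν : 0 < ν) (hν1 : ν < 1)
    (hΔ : Δ < ν / (200 * (D + 1) ^ 2)) (hA : ∀ i, 0 ≤ A i) (hA0 : A ≠ 0) {E : ℝ}
    (hE : |E - moment Δ A| ≤ ν / 4 * Δ * moment Δ A) :
    |renyi Δ E (total A) - shannonEntropy A| ≤ ν ∧
      |tsallis Δ E (total A) - shannonEntropy A| ≤ ν := by
  have hD : (0 : ℝ) ≤ D := D.cast_nonneg
  rw [lt_div_iff₀ (by positivity)] at hΔ
  -- This one condition absorbs the bias `8DΔ` and, as `T ≤ 5D`, also the logarithmic error `T²Δ ≤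
  -- 25 D²Δ`.
  have hsmall : Δ * D + Δ * D ^ 2 + Δ ≤ ν / 200 := by nlinarith [mul_nonneg h0.le hD]
  have hΔD : 0 ≤ Δ * D := by positivity
  have hΔD2 : 0 ≤ Δ * D ^ 2 := by positivity
  have h2 : Δ ≤ 1 / 2 := by linarith
  obtain ⟨b1, b2, b3, b4⟩ := moment_div_bounds h0 h2 hA hA0
  have hT := Real.rpow_pos_of_pos (total_pos hA hA0) (1 - Δ)
  have hF := moment_pos (Δ := Δ) hA hA0
  obtain ⟨e, he, rfl⟩ : ∃ e : ℝ, |e| ≤ ν / 4 * Δ ∧ E = moment Δ A * (1 + e) := by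
    refine ⟨(E - moment Δ A) / moment Δ A, ?_, ?_⟩
    · rwa [abs_div, abs_of_pos hF, div_le_iff₀ hF]
    · field_simp
      ring
  have ex : moment Δ A * (1 + e) / total A ^ (1 - Δ) =
      moment Δ A / total A ^ (1 - Δ) * (1 + e) := by ring
  rw [renyi, tsallis, ex]
  generalize moment Δ A / total A ^ (1 - Δ) = S at *
  generalize shannonEntropy A = H at *
  obtain ⟨T, rfl⟩ : ∃ T, S = 1 + T * Δ := ⟨(S - 1) / Δ, by field_simp; ring⟩
  have hHT : H ≤ T := le_of_mul_le_mul_right (by linarith) h0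
  have hTH : T ≤ H + 8 * D * Δ := le_of_mul_le_mul_right (by linarith) h0
  have hT0 : 0 ≤ T := b3.trans hHT
  have hT9 : T ≤ 5 * D := by nlinarith
  obtain ⟨f, hf, rfl⟩ : ∃ f : ℝ, |f| ≤ ν / 4 ∧ e = f * Δ := by
    refine ⟨e / Δ, ?_, by field_simp⟩
    rwa [abs_div, abs_of_pos h0, div_le_iff₀ h0]
  have hTΔ : T * Δ ≤ 1 / 40 := by nlinarith
  have hTΔ0 : 0 ≤ T * Δ := by positivity
  have hfΔ : |f * Δ| ≤ 1 / 2 := by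
    rw [abs_mul, abs_of_pos h0]
    nlinarith [abs_nonneg f]
  have hTT : T ^ 2 * Δ ≤ 25 * (Δ * D ^ 2) := by
    have : T ^ 2 ≤ (5 * D) ^ 2 := by gcongr
    calc T ^ 2 * Δ ≤ (5 * D) ^ 2 * Δ := by gcongr
      _ = 25 * (Δ * D ^ 2) := by ring
  refine ⟨abs_log_div_sub_le h0 hν hT0 hf hfΔ hHT (by linarith), ?_⟩
  have et : 1 / Δ * ((1 + T * Δ) * (1 + f * Δ) - 1) - H = (T - H) + f * (1 + T * Δ) := by
    field_simp
    ring
  rw [et]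
  have h3 : |f * (1 + T * Δ)| ≤ ν / 4 * 2 := by
    rw [abs_mul, abs_of_pos (by linarith : 0 < 1 + T * Δ)]
    gcongr
    linarith
  obtain ⟨h4, h5⟩ := abs_le.1 h3
  rw [abs_le]
  constructor <;> linarith

end

end

end CompressedCounting

/-! ### Assembly of the four claims. -/

open CompressedCounting in
theorem mainTheorem4 :
    ∃ C : ℝ, 0 < C ∧ ∃ ν₀ : ℝ, 0 < ν₀ ∧
      -- inside the disc of convergence, `M` and `M'` are the Gamma function series
      (∀ Δ : ℝ, 0 < Δ → Δ < 1 → ∀ s : ℝ, |s| < CompressedCounting.radius Δ →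
        HasSum (fun n : ℕ => s ^ n / (n.factorial : ℝ) * CompressedCounting.gammaRatio Δ n)
          (CompressedCounting.M Δ s) ∧
        HasSum (fun n : ℕ => s ^ n / (n.factorial : ℝ) * CompressedCounting.gammaRatio Δ (n + 1))
          (CompressedCounting.M' Δ s)) ∧
      -- the constants of the tail bounds, with `ε = ν * Δ`
      (∀ Δ ν : ℝ, 0 < Δ → Δ < 1 → 0 < ν → ν < 1 →
        ∃ tR tL gR gL : ℝ,
          (∀ t : ℝ, CompressedCounting.IsRightPoint Δ (ν * Δ) t ↔ t = tR) ∧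
          (∀ t : ℝ, CompressedCounting.IsLeftPoint Δ (ν * Δ) t ↔ t = tL) ∧
          (ν < ν₀ → tR < CompressedCounting.radius Δ) ∧
          (ν * Δ) ^ 2 / gR = CompressedCounting.rightRate Δ (ν * Δ) tR ∧
          (ν * Δ) ^ 2 / gL = CompressedCounting.leftRate Δ (ν * Δ) tL ∧
          -- these constants bound the tails of the estimator
          (∀ (Ω : Type*) [MeasurableSpace Ω] (μ : MeasureTheory.Measure Ω)
            [MeasureTheory.IsProbabilityMeasure μ] (D k : ℕ)
            (v w : Fin D → Fin k → Ω → ℝ), CompressedCounting.IsSource μ v w →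
            ∀ A : Fin D → ℝ, (∀ i, 0 ≤ A i) → A ≠ 0 →
              μ.real {ω | (1 + ν * Δ) * CompressedCounting.moment Δ A ≤
                  CompressedCounting.estimator Δ (CompressedCounting.project
                    (CompressedCounting.projMatrix Δ v w ω) A)} ≤
                Real.exp (-((k : ℝ) * ((ν * Δ) ^ 2 / gR))) ∧
              μ.real {ω | CompressedCounting.estimator Δ (CompressedCounting.project
                    (CompressedCounting.projMatrix Δ v w ω) A) ≤
                  (1 - ν * Δ) * CompressedCounting.moment Δ A} ≤
                Real.exp (-((k : ℝ) * ((ν * Δ) ^ 2 / gL)))) ∧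
          -- `G_R = O(Δ ^ 2)` and `G_L = O(Δ ^ 2)`
          0 < gR ∧ gR ≤ C * Δ ^ 2 ∧
          0 < gL ∧ gL ≤ C * Δ ^ 2 ∧
          -- `ε ^ 2 / G_R = O(1)` and `ε ^ 2 / G_L = O(1)`
          (ν * Δ) ^ 2 / gR ≤ C ∧
          (Δ ≤ 1 / 2 → (ν * Δ) ^ 2 / gL ≤ C)) ∧
      -- `k = O(1 / ν ^ 2)` samples suffice to estimate `F_(α)` within a factor `1 ± ν * Δ`
      (∀ Δ ν δ : ℝ, 0 < Δ → Δ < 1 → 0 < ν → ν < 1 → 0 < δ → δ < 1 →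
        ∀ (Ω : Type*) [MeasurableSpace Ω] (μ : MeasureTheory.Measure Ω)
          [MeasureTheory.IsProbabilityMeasure μ] (D k : ℕ)
          (v w : Fin D → Fin k → Ω → ℝ), CompressedCounting.IsSource μ v w →
          C * Real.log (2 / δ) / ν ^ 2 ≤ (k : ℝ) →
          ∀ A : Fin D → ℝ, (∀ i, 0 ≤ A i) → A ≠ 0 →
            1 - δ ≤ μ.real {ω |
              |CompressedCounting.estimator Δ (CompressedCounting.project
                  (CompressedCounting.projMatrix Δ v w ω) A) - CompressedCounting.moment Δ A| ≤
                ν * Δ * CompressedCounting.moment Δ A}) ∧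
      -- `k = O(1 / ν ^ 2)` samples suffice to estimate the Shannon entropy of a stream up to `ν`
      (∀ (D : ℕ) (ν : ℝ), 0 < ν → ν < 1 → ∃ Δ₀ : ℝ, 0 < Δ₀ ∧ Δ₀ < 1 ∧
        ∀ Δ δ : ℝ, 0 < Δ → Δ < Δ₀ → 0 < δ → δ < 1 →
        ∀ (Ω : Type*) [MeasurableSpace Ω] (μ : MeasureTheory.Measure Ω)
          [MeasureTheory.IsProbabilityMeasure μ] (k : ℕ)
          (v w : Fin D → Fin k → Ω → ℝ), CompressedCounting.IsSource μ v w →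
          C * Real.log (2 / δ) / ν ^ 2 ≤ (k : ℝ) →
          ∀ stream : List (Fin D × ℝ), (∀ i, 0 ≤ CompressedCounting.streamVector stream i) →
            CompressedCounting.streamVector stream ≠ 0 →
            1 - δ ≤ μ.real {ω |
              let S := CompressedCounting.sketch (CompressedCounting.projMatrix Δ v w ω) stream
              |CompressedCounting.renyi Δ (CompressedCounting.estimator Δ S.1) S.2 -
                  CompressedCounting.shannonEntropy
                    (CompressedCounting.streamVector stream)| ≤ ν ∧
              |CompressedCounting.tsallis Δ (CompressedCounting.estimator Δ S.1) S.2 -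
                  CompressedCounting.shannonEntropy
                    (CompressedCounting.streamVector stream)| ≤ ν}) := by
  -- `1536 = 96 * 16`: the factor `96` comes from the rate `ν² / 96`, and `16` from applying
  -- concentration with `ν / 4` in the entropy claim.
  refine ⟨1536, by norm_num, 1 / 4, by norm_num, fun Δ h0 h1 s hs =>
    ⟨hasSum_M h0 h1 hs, hasSum_M' h0 h1 hs⟩, ?_, ?_, ?_⟩
  · intro Δ ν h0 h1 hν hν1
    obtain ⟨tR, hR, htR, htRr, hRl, hRu⟩ := exists_rightPoint h0 h1 hν hν1
    obtain ⟨tL, hL, htL, htLr, hLl, hLu⟩ := exists_leftPoint h0 h1 hν hν1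
    have hν2 : 0 < ν ^ 2 := by positivity
    have hR0 : 0 < rightRate Δ (ν * Δ) tR := by linarith
    have hL0 : 0 < leftRate Δ (ν * Δ) tL := by linarith
    have hne : (ν * Δ) ^ 2 ≠ 0 := by positivity
    -- The constants are defined by inverting the rates, which are positive; a rate of at least `ν²
    -- / 1536` then means `G ≤ 1536 Δ²`.
    refine ⟨tR, tL, (ν * Δ) ^ 2 / rightRate Δ (ν * Δ) tR, (ν * Δ) ^ 2 / leftRate Δ (ν * Δ) tL,
      hR, hL, htRr, div_div_cancel₀ hne, div_div_cancel₀ hne, ?_, by positivity, ?_, by positivity,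
      ?_, ?_, ?_⟩
    · intro Ω _ μ _ D k v w h A hA hA0
      rw [div_div_cancel₀ hne, div_div_cancel₀ hne]
      exact ⟨right_tail_rate h h0 h1 hν hA hA0 htR, left_tail_rate h h0 h1 hν1 hA hA0 htL htLr⟩
    · rw [div_le_iff₀ hR0, mul_pow]
      calc ν ^ 2 * Δ ^ 2 ≤ (1536 * rightRate Δ (ν * Δ) tR) * Δ ^ 2 := by
            gcongr
            linarith
        _ = _ := by ring
    · rw [div_le_iff₀ hL0, mul_pow]
      calc ν ^ 2 * Δ ^ 2 ≤ (1536 * leftRate Δ (ν * Δ) tL) * Δ ^ 2 := by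
            gcongr
            linarith
        _ = _ := by ring
    · rw [div_div_cancel₀ hne]
      linarith
    · intro hΔ
      rw [div_div_cancel₀ hne]
      linarith [hLu hΔ]
  · intro Δ ν δ h0 h1 hν hν1 hδ hδ1 Ω _ μ _ D k v w h hk A hA hA0
    refine concentration h h0 h1 hν hν1 hδ (le_trans ?_ hk) hA hA0
    have : 0 ≤ Real.log (2 / δ) := Real.log_nonneg (by rw [le_div_iff₀ hδ]; linarith)
    gcongr
    norm_num
  · intro D ν hν hν1
    have hD : (0 : ℝ) ≤ D := D.cast_nonneg
    refine ⟨ν / (200 * (D + 1) ^ 2), by positivity, ?_, ?_⟩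
    · rw [div_lt_one (by positivity)]
      nlinarith
    intro Δ δ h0 hΔ hδ hδ1 Ω _ μ _ k v w h hk stream hA hA0
    have h1 : Δ < 1 := by
      refine hΔ.trans ?_
      rw [div_lt_one (by positivity)]
      nlinarith
    have hc := concentration h h0 h1 (ν := ν / 4) (by positivity) (by linarith) hδ
      (le_of_eq_of_le (by ring) hk) hA hA0
    refine hc.trans (measureReal_mono fun ω hω => ?_)
    simp only [sketch_eq, Set.mem_ofPred_eq]
    exact entropy_estimates h0 hν hν1 hΔ hA hA0 hω
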